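/- Let $k_1,k_2,k_3,k_4,\gamma>0$ and consider on $\mathbb{R}$ the Cauchy problem for $U=(v,u,z,y,\phi,\theta,\eta)^T$ with initial datum $U(\cdot,0)=U_0$ and, for $t>0$, $$\begin{cases} v_t-u_x-y-\theta=0,\\ u_t-k_1v_x=0,\\ z_t-y_x=0,\\ y_t-k_2z_x+k_1v+\gamma\eta_x=0,\\ \phi_t-\theta_x=0,\\ \theta_t-k_3\phi_x+k_1v=0,\\ \eta_t-k_4\eta_{xx}+\gamma y_x=0.\end{cases}$$ (This is the first order form of the laminated Timoshenko beam with Fourier heat conduction acting on the equation of the rotation angle.) Solutions are understood in $C([0,\infty);L^2(\mathbb{R}))$, the equations holding in the sense of distributions. **Theorem.** Let $N,\ell\in\mathbb{N}$ with $1\le\ell\le N$ and let $j\in\{0,\dots,N-\ell\}$. There exist constants $c_0,\tilde c_0>0$, depending only on $k_1,k_2,k_3,k_4,\gamma,N,\ell,j$, such that for every $U_0\in H^N(\mathbb{R})\cap L^1(\mathbb{R})$ the solution $U$ satisfies $\partial_x^jU(\cdot,t)\in L^2(\mathbb{R})$ for all $t\ge 0$ and: 1. if $k_1=k_2=k_3$,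 then for all $t\ge0$ $$\|\partial_x^jU(\cdot,t)\|_{L^2(\mathbb{R})}\le c_0(1+t)^{-1/8-j/4}\|U_0\|_{L^1(\mathbb{R})}+c_0e^{-\tilde c_0t}\|\partial_x^{j+\ell}U_0\|_{L^2(\mathbb{R})};$$ 2. if $k_1=k_2=k_3$ does not hold, then for all $t\ge0$ $$\|\partial_x^jU(\cdot,t)\|_{L^2(\mathbb{R})}\le c_0(1+t)^{-1/8-j/4}\|U_0\|_{L^1(\mathbb{R})}+c_0(1+t)^{-\ell/4}\|\partial_x^{j+\ell}U_0\|_{L^2(\mathbb{R})}.$$ -/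

import Mathlib

open MeasureTheory
open scoped SchwartzMap LineDeriv

noncomputable section

namespace LaminatedBeam

/-- The state space `ℂ⁷` with its Euclidean norm; the components of a state are, in this order,
`(v, u, z, y, φ, θ, η)`. -/
abbrev State : Type := EuclideanSpace ℂ (Fin 7)

/-- The space `L²(ℝ)` of square integrable `ℂ⁷`-valued functions. -/
abbrev L2State : Type := Lp State 2 (volume : Measure ℝ)

/-- The matrix of the second order term: `A₂ U = (0, 0, 0, 0, 0, 0, -k₄ η)`. -/
def matA2 (k₄ : ℝ) : Matrix (Fin 7) (Fin 7) ℂ :=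
  !![0, 0, 0, 0, 0, 0, 0;
     0, 0, 0, 0, 0, 0, 0;
     0, 0, 0, 0, 0, 0, 0;
     0, 0, 0, 0, 0, 0, 0;
     0, 0, 0, 0, 0, 0, 0;
     0, 0, 0, 0, 0, 0, 0;
     0, 0, 0, 0, 0, 0, -(k₄ : ℂ)]

/-- The matrix of the first order term: `A₁ U = (-u, -k₁ v + τ₁ γ η, -y, -k₂ z + τ₂ γ η, -θ,
-k₃ φ + τ₃ γ η, γ (τ₁ u + τ₂ y + τ₃ θ))`. -/
def matA1 (k₁ k₂ k₃ γ τ₁ τ₂ τ₃ : ℝ) : Matrix (Fin 7) (Fin 7) ℂ :=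
  !![0, -1, 0, 0, 0, 0, 0;
     -(k₁ : ℂ), 0, 0, 0, 0, 0, (τ₁ : ℂ) * γ;
     0, 0, 0, -1, 0, 0, 0;
     0, 0, -(k₂ : ℂ), 0, 0, 0, (τ₂ : ℂ) * γ;
     0, 0, 0, 0, 0, -1, 0;
     0, 0, 0, 0, -(k₃ : ℂ), 0, (τ₃ : ℂ) * γ;
     0, (γ : ℂ) * τ₁, 0, (γ : ℂ) * τ₂, 0, (γ : ℂ) * τ₃, 0]

/-- The matrix of the zeroth order term: `A₀ U = (-y - θ, 0, 0, k₁ v, 0, k₁ v, 0)`. -/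
def matA0 (k₁ : ℝ) : Matrix (Fin 7) (Fin 7) ℂ :=
  !![0, 0, 0, -1, 0, -1, 0;
     0, 0, 0, 0, 0, 0, 0;
     0, 0, 0, 0, 0, 0, 0;
     (k₁ : ℂ), 0, 0, 0, 0, 0, 0;
     0, 0, 0, 0, 0, 0, 0;
     (k₁ : ℂ), 0, 0, 0, 0, 0, 0;
     0, 0, 0, 0, 0, 0, 0]

/-- The action of a matrix on a state. -/
def act (A : Matrix (Fin 7) (Fin 7) ℂ) (X : State) : State := WithLp.toLp 2 (A.mulVec X)

/-- `U` is the solution in `C([0, ∞); L²(ℝ))` of the Cauchy problem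
`U_t + A₂ U_xx + A₁ U_x + A₀ U = 0`, `U(·, 0) = U₀`. The equation is understood in the sense of
tempered distributions in `x`, with the time derivative taken in the weak topology: for every
Schwartz function `φ` and every `t > 0`, the pairing `⟨U(s), φ⟩ ∈ ℂ⁷` is differentiable in `s` at
`t`, with derivative `-(A₂ ⟨∂ₓ² U(t), φ⟩ + A₁ ⟨∂ₓ U(t), φ⟩ + A₀ ⟨U(t), φ⟩)`.
Values of `U` at negative times play no role. -/
structure IsSolution (k₁ k₂ k₃ k₄ γ τ₁ τ₂ τ₃ : ℝ) (U₀ : L2State) (U : ℝ → L2State) : Prop where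
  continuousOn : ContinuousOn U (Set.Ici 0)
  initial : U 0 = U₀
  equation : ∀ t : ℝ, 0 < t → ∀ φ : 𝓢(ℝ, ℂ),
    HasDerivAt (fun s : ℝ => (U s : 𝓢'(ℝ, State)) φ)
      (-(act (matA2 k₄) ((∂_{(1 : ℝ)} (∂_{(1 : ℝ)} (U t : 𝓢'(ℝ, State)))) φ)
        + act (matA1 k₁ k₂ k₃ γ τ₁ τ₂ τ₃) ((∂_{(1 : ℝ)} (U t : 𝓢'(ℝ, State))) φ)
        + act (matA0 k₁) ((U t : 𝓢'(ℝ, State)) φ))) t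

/-- The function `f ∈ L²(ℝ)` has the `m`-th order weak (distributional) derivative `g ∈ L²(ℝ)`. -/
def HasL2Deriv (m : ℕ) (f g : L2State) : Prop :=
  (LineDeriv.lineDerivOp (1 : ℝ))^[m] (f : 𝓢'(ℝ, State)) = (g : 𝓢'(ℝ, State))

/-- The Sobolev space `H^N(ℝ)` of `ℂ⁷`-valued functions. -/
def MemH (N : ℕ) (f : L2State) : Prop :=
  TemperedDistribution.MemSobolev (N : ℝ) 2 (f : 𝓢'(ℝ, State))

end LaminatedBeam

end

/-! In Fourier variables the system is the family of linear ODEs X' = A(ω)X in ℂ⁷, with A(ω) the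
`symbol`, so everything reduces to a bound ‖exp(tA(ω))‖ ≤ K exp(-c ρ(ω) t) uniform in ω. Here ρ is
`rate q`: ω⁴ for |ω| ≤ 1, and |ω|^(-q) beyond, with q = 0 for equal wave speeds and q = 4 in
general.

The weighted energy is nonincreasing, which bounds the semigroups uniformly, but it dissipates only
through k₄ω²|η|². That the other six components are damped too is extracted from the resolvent on
the imaginary axis. In `resolvent_bound`, if ρ(ω)‖x‖ ≤ C‖(iL - A(ω))x‖ failed for every C, there
would be unit vectors with residual o(ρ). Dissipation then gives ωη = o(√ρ), and the seven equations
pass this smallness from η to y and on to all the others, contradicting the unit norm. The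
quantitative Gearhart–Prüss theorem (`exp_decay_of_resolvent`), whose constants depend only on the
bound of the semigroup, turns the resolvent bound into the decay exp(-cρ(ω)t).

A solution is only weak, so `IsSolution.fourier_ae_eq` is needed to identify its Fourier transform
with exp(tA(2πξ)) applied to that of the datum, by testing against the backward evolution.

By Plancherel the estimate is then an integral split at |ω| = 1. Below, the transform of the datum
is bounded by the L¹ norm, and scaling of ∫|ω|^(2j) exp(-2c(1+t)ω⁴) yields (1+t)^(-1/8-j/4) after a
square root. Above, ρ = 1 gives exponential decay, while ρ = |ω|^(-4) trades ℓ derivatives for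
(1+t)^(-ℓ/4). -/

namespace LaminatedBeam

/-! ### Asymptotics of approximate eigenmodes -/

section Resolvent

open Asymptotics Filter Complex

variable {ι : Type*} {l : Ultrafilter ι}

/-- Along an ultrafilter any two functions are comparable. -/
theorem isBigO_or_isLittleO (f g : ι → ℂ) : f =O[(l : Filter ι)] g ∨ g =o[(l : Filter ι)] f := by
  by_cases h : f =O[(l : Filter ι)] g
  · exact Or.inl h
  · right
    rw [isLittleO_iff]
    intro c hc
    have h1 : ¬ ∀ᶠ x in (l : Filter ι), ‖f x‖ ≤ c⁻¹ * ‖g x‖ := fun h' => h (IsBigO.of_bound _ h')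
    rw [← Ultrafilter.eventually_not] at h1
    filter_upwards [h1] with x hx
    push Not at hx
    have := mul_le_mul_of_nonneg_left hx.le hc.le
    rwa [← mul_assoc, mul_inv_cancel₀ hc.ne', one_mul] at this

theorem IsLittleO.cancel {l : Filter ι} {a f g : ι → ℂ} (ha : ∀ᶠ n in l, a n ≠ 0)
    (h : (fun n => a n * f n) =o[l] fun n => a n * g n) : f =o[l] g := by
  rw [isLittleO_iff] at h ⊢
  intro c hc
  filter_upwards [h hc, ha] with n h1 h2
  rw [norm_mul, norm_mul, mul_left_comm] at h1
  exact le_of_mul_le_mul_left h1 (norm_pos_iff.2 h2)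

theorem IsBigO.cancel {l : Filter ι} {a f g : ι → ℂ} (ha : ∀ᶠ n in l, a n ≠ 0)
    (h : (fun n => a n * f n) =O[l] fun n => a n * g n) : f =O[l] g := by
  rw [isBigO_iff] at h ⊢
  obtain ⟨c, h⟩ := h
  refine ⟨c, ?_⟩
  filter_upwards [h, ha] with n h1 h2
  rw [norm_mul, norm_mul, mul_left_comm] at h1
  exact le_of_mul_le_mul_left h1 (norm_pos_iff.2 h2)

/-- A quantity whose product with a divergent factor is bounded tends to zero. -/
theorem isLittleO_one_of_mul_isBigO {l : Filter ι} {g a : ι → ℂ}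
    (hg : (fun _ => (1 : ℂ)) =o[l] g) (h : (fun n => g n * a n) =O[l] fun _ => (1 : ℂ)) :
    a =o[l] fun _ => (1 : ℂ) := by
  have h0 : ∀ᶠ n in l, g n ≠ 0 := by
    filter_upwards [hg.bound one_pos] with n hn h0
    simp [h0] at hn
    linarith
  exact IsLittleO.cancel h0 ((h.trans_isLittleO hg).congr_right fun n => by ring)

/-- Two coupled transport equations away from their characteristics. -/
theorem pair_isLittleO {l : Filter ι} {L w g a b : ι → ℂ} {p : ℂ}
    (hg : (fun _ => (1 : ℂ)) =o[l] g) (hL : L =O[l] g) (hw : w =O[l] g)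
    (hd : (fun n => g n ^ 2) =O[l] fun n => L n ^ 2 - p * w n ^ 2)
    (h1 : (fun n => L n * a n - w n * b n) =O[l] fun _ => (1 : ℂ))
    (h2 : (fun n => L n * b n - p * w n * a n) =O[l] fun _ => (1 : ℂ)) :
    a =o[l] (fun _ => (1 : ℂ)) ∧ b =o[l] fun _ => (1 : ℂ) := by
  have h0 : ∀ᶠ n in l, g n ≠ 0 := by
    filter_upwards [hg.bound one_pos] with n hn h0
    simp [h0] at hn
    linarith
  -- Cramer's rule: eliminating either unknown leaves the determinant L² - p w², of size at least
  -- g², times the other unknown, while the right-hand side is only O(g).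
  have key : ∀ c : ι → ℂ, (fun n => (L n ^ 2 - p * w n ^ 2) * c n) =O[l] g →
      c =o[l] fun _ => (1 : ℂ) := by
    intro c hc
    have h3 : (fun n => g n ^ 2 * c n) =O[l] g := (hd.mul (isBigO_refl c l)).trans hc
    refine isLittleO_one_of_mul_isBigO hg (IsBigO.cancel h0 ?_)
    exact (h3.congr_left fun n => by ring).congr_right fun n => by ring
  constructor
  · apply key
    exact (((hL.mul h1).add (hw.mul h2)).congr_left fun n => by ring).congr_right fun n => by ring
  · apply key
    exact (((hL.mul h2).add ((hw.const_mul_left p).mul h1)).congr_left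
      fun n => by ring).congr_right fun n => by ring

/-- A bounded family of states `(v, u, z, y, φ, θ, η)` together with frequencies `w` and spectral
parameters `L` such that the residuals of the resolvent equation are `o(m)`. -/
structure ApproxMode (k₁ k₂ k₃ k₄ γ : ℂ) (l : Filter ι) (m w L v u z y φ θ η : ι → ℂ) : Prop where
  bv : v =O[l] fun _ => (1 : ℂ)
  bu : u =O[l] fun _ => (1 : ℂ)
  bz : z =O[l] fun _ => (1 : ℂ)
  by' : y =O[l] fun _ => (1 : ℂ)
  bφ : φ =O[l] fun _ => (1 : ℂ)
  bθ : θ =O[l] fun _ => (1 : ℂ)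
  bη : η =O[l] fun _ => (1 : ℂ)
  r1 : (fun n => I * L n * v n - I * w n * u n - y n - θ n) =o[l] m
  r2 : (fun n => I * L n * u n - I * k₁ * w n * v n) =o[l] m
  r3 : (fun n => I * L n * z n - I * w n * y n) =o[l] m
  r4 : (fun n => I * L n * y n - I * k₂ * w n * z n + k₁ * v n + γ * I * w n * η n) =o[l] m
  r5 : (fun n => I * L n * φ n - I * w n * θ n) =o[l] m
  r6 : (fun n => I * L n * θ n - I * k₃ * w n * φ n + k₁ * v n) =o[l] m
  r7 : (fun n => I * L n * η n + k₄ * w n ^ 2 * η n + γ * I * w n * y n) =o[l] m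

/-- All components tend to zero. -/
def Vanishes (l : Filter ι) (v u z y φ θ η : ι → ℂ) : Prop :=
  (v =o[l] fun _ => (1 : ℂ)) ∧ (u =o[l] fun _ => (1 : ℂ)) ∧ (z =o[l] fun _ => (1 : ℂ)) ∧
  (y =o[l] fun _ => (1 : ℂ)) ∧ (φ =o[l] fun _ => (1 : ℂ)) ∧ (θ =o[l] fun _ => (1 : ℂ)) ∧
  (η =o[l] fun _ => (1 : ℂ))

theorem of_const_mul {l : Filter ι} {c : ℂ} (hc : c ≠ 0) {f g h : ι → ℂ} (hf : f =o[l] g)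
    (e : ∀ n, f n = c * h n) : h =o[l] g :=
  (isLittleO_const_mul_left_iff hc).1 (hf.congr_left e)

variable {k₁ k₂ k₃ k₄ γ : ℂ} {m w L v u z y φ θ η : ι → ℂ}

theorem ApproxMode.mono {l : Filter ι} {m' : ι → ℂ}
    (h : ApproxMode k₁ k₂ k₃ k₄ γ l m w L v u z y φ θ η)
    (hm : m =O[l] m') : ApproxMode k₁ k₂ k₃ k₄ γ l m' w L v u z y φ θ η :=
  { h with
    r1 := h.r1.trans_isBigO hm
    r2 := h.r2.trans_isBigO hm
    r3 := h.r3.trans_isBigO hm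
    r4 := h.r4.trans_isBigO hm
    r5 := h.r5.trans_isBigO hm
    r6 := h.r6.trans_isBigO hm
    r7 := h.r7.trans_isBigO hm }

/-- Bounded frequencies, large spectral parameter. -/
theorem ApproxMode.vanishes_of_large {l : Filter ι}
    (h : ApproxMode k₁ k₂ k₃ k₄ γ l (fun _ => 1) w L v u z y φ θ η)
    (hw : w =O[l] fun _ => (1 : ℂ)) (hL : (fun _ => (1 : ℂ)) =o[l] L) :
    Vanishes l v u z y φ θ η := by
  obtain ⟨bv, bu, bz, by', bφ, bθ, bη, r1, r2, r3, r4, r5, r6, r7⟩ := h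
  have key : ∀ a : ι → ℂ, (fun n => I * L n * a n) =O[l] (fun _ => (1 : ℂ)) →
      a =o[l] fun _ => (1 : ℂ) := by
    intro a ha
    apply isLittleO_one_of_mul_isBigO hL
    exact (ha.const_mul_left (-I)).congr_left fun n => by
      linear_combination (- L n * a n) * I_mul_I
  have P : ∀ {a : ι → ℂ}, a =O[l] (fun _ => (1 : ℂ)) →
      (fun n => w n * a n) =O[l] (fun _ => (1 : ℂ)) := fun ha =>
    (hw.mul ha).congr_right fun n => by ring
  refine ⟨key _ ?_, key _ ?_, key _ ?_, key _ ?_, key _ ?_, key _ ?_, key _ ?_⟩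
  · exact (((r1.isBigO.add ((P bu).const_mul_left I)).add by').add bθ).congr_left
      fun n => by ring
  · exact (r2.isBigO.add ((P bv).const_mul_left (I * k₁))).congr_left fun n => by ring
  · exact (r3.isBigO.add ((P by').const_mul_left I)).congr_left fun n => by ring
  · exact (((r4.isBigO.add ((P bz).const_mul_left (I * k₂))).sub (bv.const_mul_left k₁)).sub
      ((P bη).const_mul_left (γ * I))).congr_left fun n => by ring
  · exact (r5.isBigO.add ((P bθ).const_mul_left I)).congr_left fun n => by ring
  · exact ((r6.isBigO.add ((P bφ).const_mul_left (I * k₃))).sub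
      (bv.const_mul_left k₁)).congr_left fun n => by ring
  · exact ((r7.isBigO.sub ((P (P bη)).const_mul_left k₄)).sub
      ((P by').const_mul_left (γ * I))).congr_left fun n => by ring

/-- Frequencies bounded and bounded away from zero. -/
theorem ApproxMode.vanishes_of_medium
    (h : ApproxMode k₁ k₂ k₃ k₄ γ l (fun _ => 1) w L v u z y φ θ η)
    (hk₁ : k₁ ≠ 0) (hk₂ : k₂ ≠ 0) (hk₃ : k₃ ≠ 0) (hγ : γ ≠ 0)
    (hη : (fun n => w n * η n) =o[(l : Filter ι)] fun _ => (1 : ℂ))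
    (hw : w =O[(l : Filter ι)] fun _ => (1 : ℂ)) (hw' : (fun _ => (1 : ℂ)) =O[(l : Filter ι)] w) :
    Vanishes (l : Filter ι) v u z y φ θ η := by
  rcases isBigO_or_isLittleO (l := l) L (fun _ => 1) with hL | hL
  swap
  · exact h.vanishes_of_large hw hL
  obtain ⟨bv, bu, bz, by', bφ, bθ, bη, r1, r2, r3, r4, r5, r6, r7⟩ := h
  have Q : ∀ {c a : ι → ℂ}, (fun _ => (1 : ℂ)) =O[(l : Filter ι)] c →
      (fun n => c n * a n) =o[(l : Filter ι)] (fun _ => (1 : ℂ)) →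
      a =o[(l : Filter ι)] (fun _ => (1 : ℂ)) := by
    intro c a hc ha
    exact ((hc.mul (isBigO_refl a (l : Filter ι))).trans_isLittleO ha).congr_left
      fun n => by ring
  have W : ∀ {a : ι → ℂ}, a =o[(l : Filter ι)] (fun _ => (1 : ℂ)) →
      (fun n => w n * a n) =o[(l : Filter ι)] (fun _ => (1 : ℂ)) := fun ha =>
    (hw.mul_isLittleO ha).congr_right fun n => by ring
  have LL : ∀ {a : ι → ℂ}, a =o[(l : Filter ι)] (fun _ => (1 : ℂ)) →
      (fun n => L n * a n) =o[(l : Filter ι)] (fun _ => (1 : ℂ)) := fun ha =>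
    (hL.mul_isLittleO ha).congr_right fun n => by ring
  have oη := Q hw' hη
  have oy : y =o[(l : Filter ι)] (fun _ => (1 : ℂ)) := by
    apply Q hw'
    exact of_const_mul (mul_ne_zero hγ I_ne_zero)
      ((r7.sub ((LL oη).const_mul_left I)).sub ((W (W oη)).const_mul_left k₄)) fun n => by ring
  -- Once η and y are small, the fourth equation ties v to w z. Multiplying this relation by L
  -- transfers the smallness of L z, known from the third equation, to L v.
  have oa : (fun n => I * k₂ * (w n * z n) - k₁ * v n) =o[(l : Filter ι)] (fun _ => (1 : ℂ)) :=
    ((((LL oy).const_mul_left I).add (hη.const_mul_left (γ * I))).sub r4).congr_left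
      fun n => by ring
  have oLz : (fun n => L n * z n) =o[(l : Filter ι)] (fun _ => (1 : ℂ)) :=
    of_const_mul I_ne_zero (r3.add ((W oy).const_mul_left I)) fun n => by ring
  have oLv : (fun n => L n * v n) =o[(l : Filter ι)] (fun _ => (1 : ℂ)) :=
    of_const_mul hk₁ (((W oLz).const_mul_left (I * k₂)).sub (LL oa)) fun n => by ring
  have oc : (fun n => I * (w n * u n) + θ n) =o[(l : Filter ι)] (fun _ => (1 : ℂ)) :=
    (((oLv.const_mul_left I).sub oy).sub r1).congr_left fun n => by ring
  rcases isBigO_or_isLittleO (l := l) (fun _ => 1) L with hL' | hL'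
  · have ov := Q hL' oLv
    have oz := Q hL' oLz
    have ou : u =o[(l : Filter ι)] (fun _ => (1 : ℂ)) := Q hL' <|
      of_const_mul I_ne_zero (r2.add ((W ov).const_mul_left (I * k₁))) fun n => by ring
    have oθ : θ =o[(l : Filter ι)] (fun _ => (1 : ℂ)) :=
      (oc.sub ((W ou).const_mul_left I)).congr_left fun n => by ring
    have oφ : φ =o[(l : Filter ι)] (fun _ => (1 : ℂ)) := Q hL' <|
      of_const_mul I_ne_zero (r5.add ((W oθ).const_mul_left I)) fun n => by ring
    exact ⟨ov, ou, oz, oy, oφ, oθ, oη⟩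
  · have S : ∀ {a : ι → ℂ}, a =O[(l : Filter ι)] (fun _ => (1 : ℂ)) →
        (fun n => L n * a n) =o[(l : Filter ι)] (fun _ => (1 : ℂ)) := fun ha =>
      (hL'.mul_isBigO ha).congr_right fun n => by ring
    have ov : v =o[(l : Filter ι)] (fun _ => (1 : ℂ)) := Q hw' <|
      of_const_mul (mul_ne_zero I_ne_zero hk₁) (((S bu).const_mul_left I).sub r2) fun n => by ring
    have oz : z =o[(l : Filter ι)] (fun _ => (1 : ℂ)) := Q hw' <|
      of_const_mul (mul_ne_zero I_ne_zero hk₂) (oa.add (ov.const_mul_left k₁)) fun n => by ring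
    have oθ : θ =o[(l : Filter ι)] (fun _ => (1 : ℂ)) := Q hw' <|
      of_const_mul I_ne_zero (((S bφ).const_mul_left I).sub r5) fun n => by ring
    have ou : u =o[(l : Filter ι)] (fun _ => (1 : ℂ)) := Q hw' <|
      of_const_mul I_ne_zero (oc.sub oθ) fun n => by ring
    have oφ : φ =o[(l : Filter ι)] (fun _ => (1 : ℂ)) := Q hw' <|
      of_const_mul (mul_ne_zero I_ne_zero hk₃)
        ((((LL oθ).const_mul_left I).add (ov.const_mul_left k₁)).sub r6) fun n => by ring
    exact ⟨ov, ou, oz, oy, oφ, oθ, oη⟩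

/-- Frequencies tending to zero. -/
theorem ApproxMode.vanishes_of_low
    (h : ApproxMode k₁ k₂ k₃ k₄ γ l (fun n => w n ^ 4) w L v u z y φ θ η)
    (hk₁ : k₁ ≠ 0) (hk₂ : k₂ ≠ 0) (hk₃ : k₃ ≠ 0) (hγ : γ ≠ 0)
    (hη : (fun n => w n * η n) =o[(l : Filter ι)] fun n => w n ^ 2)
    (hw : w =o[(l : Filter ι)] fun _ => (1 : ℂ)) (hw0 : ∀ᶠ n in (l : Filter ι), w n ≠ 0) :
    Vanishes (l : Filter ι) v u z y φ θ η := by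
  set F : Filter ι := (l : Filter ι) with hF
  -- The residuals are needed only up to o(w²). The fourth power in the rate is dictated by
  -- dissipation, which controls the square of w η and so yields just o(w²) for it.
  have w21 : (fun n => w n ^ 2) =o[F] w := (hw.mul_isBigO (isBigO_refl w F)).congr
    (fun n => by ring) fun n => by ring
  have w32 : (fun n => w n ^ 3) =o[F] fun n => w n ^ 2 :=
    (hw.mul_isBigO (isBigO_refl (fun n => w n ^ 2) F)).congr
    (fun n => by ring) fun n => by ring
  have w43 : (fun n => w n ^ 4) =o[F] fun n => w n ^ 3 :=
    (hw.mul_isBigO (isBigO_refl (fun n => w n ^ 3) F)).congr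
    (fun n => by ring) fun n => by ring
  have w42 := w43.trans w32
  have w41 := w42.trans w21
  have w40 := w41.trans hw
  rcases isBigO_or_isLittleO (l := l) L (fun _ => 1) with hL | hL
  swap
  · exact (h.mono w40.isBigO).vanishes_of_large hw.isBigO hL
  obtain ⟨bv, bu, bz, by', bφ, bθ, bη, r1, r2, r3, r4, r5, r6, r7⟩ := h
  have C : ∀ {a g : ι → ℂ}, (fun n => w n * a n) =o[F] (fun n => w n * g n) → a =o[F] g :=
    fun ha => IsLittleO.cancel hw0 ha
  have W : ∀ {a : ι → ℂ} {g : ι → ℂ}, a =o[F] g → (fun n => w n * a n) =o[F] fun n => w n * g n :=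
    fun ha => (isBigO_refl w F).mul_isLittleO ha
  have W1 : ∀ {a : ι → ℂ}, a =o[F] (fun _ => (1 : ℂ)) → (fun n => w n * a n) =o[F] w :=
    fun ha => (W ha).congr_right fun n => by ring
  have W0 : ∀ {a : ι → ℂ}, a =O[F] (fun _ => (1 : ℂ)) →
      (fun n => w n * a n) =o[F] (fun _ => (1 : ℂ)) :=
    fun ha => (hw.mul_isBigO ha).congr_right fun n => by ring
  have LL : ∀ {a g : ι → ℂ}, a =o[F] g → (fun n => L n * a n) =o[F] g := fun ha =>
    (hL.mul_isLittleO ha).congr_right fun n => by ring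
  have oη1 : η =o[F] w := C (hη.congr_right fun n => by ring)
  have oη := oη1.trans hw
  have hη3 : (fun n => w n * (w n * η n)) =o[F] fun n => w n ^ 3 :=
    (W hη).congr_right fun n => by ring
  have oy : y =o[F] (fun _ => (1 : ℂ)) := by
    apply C (g := fun _ => 1)
    simp only [mul_one]
    exact of_const_mul (c := γ * I) (mul_ne_zero hγ I_ne_zero)
      (((r7.trans w41).sub ((LL oη1).const_mul_left I)).sub
        ((hη3.trans (w32.trans w21)).const_mul_left k₄)) fun n => by ring
  have ov : v =o[F] (fun _ => (1 : ℂ)) :=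
    of_const_mul hk₁ ((((r4.trans w40).sub ((LL oy).const_mul_left I)).add
      ((W0 bz).const_mul_left (I * k₂))).sub ((W0 bη).const_mul_left (γ * I))) fun n => by ring
  have oθ : θ =o[F] (fun _ => (1 : ℂ)) :=
    (((((LL ov).const_mul_left I).sub ((W0 bu).const_mul_left I)).sub oy).sub
      (r1.trans w40)).congr_left fun n => by ring
  have D : ∀ {c a : ι → ℂ}, w =O[F] c → (fun n => c n * a n) =o[F] w →
      a =o[F] (fun _ => (1 : ℂ)) := by
    intro c a hc ha
    apply C (g := fun _ => 1)
    simp only [mul_one]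
    exact (hc.mul (isBigO_refl a F)).trans_isLittleO ha
  rcases isBigO_or_isLittleO (l := l) w L with hwL | hLw
  · have oz : z =o[F] (fun _ => (1 : ℂ)) := D hwL <|
      of_const_mul I_ne_zero ((r3.trans w41).add ((W1 oy).const_mul_left I)) fun n => by ring
    have ou : u =o[F] (fun _ => (1 : ℂ)) := D hwL <|
      of_const_mul I_ne_zero ((r2.trans w41).add ((W1 ov).const_mul_left (I * k₁)))
        fun n => by ring
    have oφ : φ =o[F] (fun _ => (1 : ℂ)) := D hwL <|
      of_const_mul I_ne_zero ((r5.trans w41).add ((W1 oθ).const_mul_left I)) fun n => by ring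
    exact ⟨ov, ou, oz, oy, oφ, oθ, oη⟩
  -- From here L = o(w). This gains one power of w in each term carrying L, so the earlier bounds on
  -- y and on the fourth equation can be sharpened.
  have Lw : ∀ {a : ι → ℂ}, a =o[F] w → (fun n => L n * a n) =o[F] fun n => w n ^ 2 :=
    fun ha => (hLw.isBigO.mul_isLittleO ha).congr_right fun n => by ring
  have L1 : ∀ {a : ι → ℂ}, a =o[F] (fun _ => (1 : ℂ)) → (fun n => L n * a n) =o[F] w :=
    fun ha => (hLw.isBigO.mul_isLittleO ha).congr_right fun n => by ring
  have Ww : ∀ {a : ι → ℂ}, a =o[F] w → (fun n => w n * a n) =o[F] fun n => w n ^ 2 :=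
    fun ha => (W ha).congr_right fun n => by ring
  have C2 : ∀ {a : ι → ℂ}, (fun n => w n * a n) =o[F] (fun n => w n ^ 2) → a =o[F] w :=
    fun ha => C (ha.congr_right fun n => by ring)
  have C1 : ∀ {a : ι → ℂ}, (fun n => w n * a n) =o[F] w → a =o[F] (fun _ => (1 : ℂ)) :=
    fun ha => C (ha.congr_right fun n => by ring)
  have oy1 : y =o[F] w := C2 <|
    of_const_mul (c := γ * I) (mul_ne_zero hγ I_ne_zero)
      (((r7.trans w42).sub ((Lw oη1).const_mul_left I)).sub
        ((hη3.trans w32).const_mul_left k₄)) fun n => by ring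
  have oa : (fun n => I * k₂ * (w n * z n) - k₁ * v n) =o[F] (fun n => w n ^ 2) :=
    ((((Lw oy1).const_mul_left I).add (hη.const_mul_left (γ * I))).sub (r4.trans w42)).congr_left
      fun n => by ring
  have oLz : (fun n => L n * z n) =o[F] (fun n => w n ^ 2) :=
    of_const_mul I_ne_zero ((r3.trans w42).add ((Ww oy1).const_mul_left I)) fun n => by ring
  have oc : (fun n => I * (w n * u n) + θ n) =o[F] w :=
    ((((L1 ov).const_mul_left I).sub oy1).sub (r1.trans w41)).congr_left fun n => by ring
  have D2 : ∀ {a : ι → ℂ}, (fun n => w n ^ 2) =O[F] L → (fun n => L n * a n) =o[F]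
      (fun n => w n ^ 2) → a =o[F] (fun _ => (1 : ℂ)) := by
    intro a hc ha
    refine C1 (C2 ?_)
    exact ((hc.mul (isBigO_refl a F)).trans_isLittleO ha).congr_left fun n => by ring
  rcases isBigO_or_isLittleO (l := l) (fun n => w n ^ 2) L with hwL | hLw2
  · have oz := D2 hwL oLz
    have ov1 : v =o[F] w := of_const_mul hk₁
      (((W1 oz).const_mul_left (I * k₂)).sub (oa.trans w21)) fun n => by ring
    have ou : u =o[F] (fun _ => (1 : ℂ)) := D2 hwL <|
      of_const_mul I_ne_zero ((r2.trans w42).add ((Ww ov1).const_mul_left (I * k₁)))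
        fun n => by ring
    have oθ1 : θ =o[F] w := (oc.sub ((W1 ou).const_mul_left I)).congr_left fun n => by ring
    have oφ : φ =o[F] (fun _ => (1 : ℂ)) := D2 hwL <|
      of_const_mul I_ne_zero ((r5.trans w42).add ((Ww oθ1).const_mul_left I)) fun n => by ring
    exact ⟨ov, ou, oz, oy, oφ, oθ, oη⟩
  · have L2 : ∀ {a : ι → ℂ}, a =O[F] (fun _ => (1 : ℂ)) →
        (fun n => L n * a n) =o[F] fun n => w n ^ 2 :=
      fun ha => (hLw2.mul_isBigO ha).congr_right fun n => by ring
    -- The fourth and sixth equations share the term k₁ v. Subtracting them removes it and links φ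
    -- to z, which closes the case L = o(w²).
    have ob : (fun n => k₃ * φ n - k₂ * z n) =o[F] w := C2 <|
      of_const_mul I_ne_zero ((((L2 bθ).const_mul_left I).sub oa).sub (r6.trans w42))
        fun n => by ring
    have oθ1 : θ =o[F] w := C2 <|
      of_const_mul I_ne_zero (((L2 bφ).const_mul_left I).sub (r5.trans w42)) fun n => by ring
    have ou : u =o[F] (fun _ => (1 : ℂ)) := C1 <|
      of_const_mul I_ne_zero (oc.sub oθ1) fun n => by ring
    have ov1 : v =o[F] w := C2 <|
      of_const_mul (mul_ne_zero I_ne_zero hk₁)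
        (((L2 bu).const_mul_left I).sub (r2.trans w42)) fun n => by ring
    have oz : z =o[F] (fun _ => (1 : ℂ)) := C1 <|
      of_const_mul (mul_ne_zero I_ne_zero hk₂) ((oa.trans w21).add (ov1.const_mul_left k₁))
        fun n => by ring
    have oφ : φ =o[F] (fun _ => (1 : ℂ)) :=
      of_const_mul hk₃ ((ob.trans hw).add (oz.const_mul_left k₂)) fun n => by ring
    exact ⟨ov, ou, oz, oy, oφ, oθ, oη⟩

/-- High frequencies, with a spectral parameter outside of the characteristic region. -/
theorem ApproxMode.vanishes_of_elliptic {l : Filter ι}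
    (h : ApproxMode k₁ k₂ k₃ k₄ γ l (fun _ => 1) w L v u z y φ θ η)
    (hη : (fun n => w n * η n) =o[l] fun _ => (1 : ℂ))
    (hw : (fun _ => (1 : ℂ)) =o[l] w) (hwL : w =o[l] L) :
    Vanishes l v u z y φ θ η := by
  obtain ⟨bv, bu, bz, by', bφ, bθ, bη, r1, r2, r3, r4, r5, r6, r7⟩ := h
  have hd : ∀ p : ℂ, (fun n => L n ^ 2) =O[l] fun n => L n ^ 2 - p * w n ^ 2 := by
    intro p
    have h1 : (fun n => p * w n ^ 2) =o[l] fun n => L n ^ 2 := (hwL.pow two_pos).const_mul_left p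
    exact h1.right_isBigO_sub
  have hL := hw.trans hwL
  have T : ∀ {f g : ι → ℂ}, f =O[l] (fun _ => (1 : ℂ)) → (∀ n, f n = I * g n) →
      g =O[l] (fun _ => (1 : ℂ)) := by
    intro f g hf e
    exact (isBigO_const_mul_left_iff I_ne_zero).1 (hf.congr_left e)
  -- Up to bounded terms the first six equations form three independent wave pairs, and w = o(L)
  -- keeps L away from each characteristic set L² = kᵢ w².
  obtain ⟨ov, ou⟩ := pair_isLittleO (a := v) (b := u) hL (isBigO_refl L l) hwL.isBigO (hd k₁)
    (T ((r1.isBigO.add by').add bθ) fun n => by ring)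
    (T r2.isBigO fun n => by ring)
  obtain ⟨oz, oy⟩ := pair_isLittleO (a := z) (b := y) hL (isBigO_refl L l) hwL.isBigO (hd k₂)
    (T r3.isBigO fun n => by ring)
    (T ((r4.isBigO.sub (bv.const_mul_left k₁)).sub (hη.isBigO.const_mul_left (γ * I)))
      fun n => by ring)
  obtain ⟨oφ, oθ⟩ := pair_isLittleO (a := φ) (b := θ) hL (isBigO_refl L l) hwL.isBigO (hd k₃)
    (T r5.isBigO fun n => by ring)
    (T (r6.isBigO.sub (bv.const_mul_left k₁)) fun n => by ring)
  exact ⟨ov, ou, oz, oy, oφ, oθ, isLittleO_one_of_mul_isBigO hw hη.isBigO⟩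

open scoped ComplexConjugate

/-- High frequencies, equal wave speeds. -/
theorem ApproxMode.vanishes_of_high_of_eq {k k₄ γ : ℝ} {w L : ι → ℝ}
    (h : ApproxMode k k k k₄ γ l (fun _ => 1) (fun n => w n) (fun n => L n) v u z y φ θ η)
    (hk : k ≠ 0) (hγ : γ ≠ 0)
    (hη : (fun n => (w n : ℂ) * η n) =o[(l : Filter ι)] fun _ => (1 : ℂ))
    (hw : (fun _ => (1 : ℂ)) =o[(l : Filter ι)] fun n => (w n : ℂ)) :
    Vanishes (l : Filter ι) v u z y φ θ η := by
  rcases isBigO_or_isLittleO (l := l) (fun n => (L n : ℂ)) (fun n => (w n : ℂ)) with hL | hL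
  swap
  · exact h.vanishes_of_elliptic hη hw hL
  obtain ⟨bv, bu, bz, by', bφ, bθ, bη, r1, r2, r3, r4, r5, r6, r7⟩ := h
  set F : Filter ι := (l : Filter ι) with hF
  have hk' : (k : ℂ) ≠ 0 := by exact_mod_cast hk
  have hγ' : (γ : ℂ) ≠ 0 := by exact_mod_cast hγ
  have hw0 : ∀ᶠ n in F, (w n : ℂ) ≠ 0 := by
    filter_upwards [hw.bound one_pos] with n hn h0
    simp [h0] at hn
    linarith
  have C1 : ∀ {a : ι → ℂ}, (fun n => (w n : ℂ) * a n) =o[F] (fun n => (w n : ℂ)) →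
      a =o[F] (fun _ => (1 : ℂ)) := fun ha =>
    IsLittleO.cancel hw0 (ha.congr_right fun n => by ring)
  have W : ∀ {a : ι → ℂ}, a =o[F] (fun _ => (1 : ℂ)) →
      (fun n => (w n : ℂ) * a n) =o[F] (fun n => (w n : ℂ)) := fun ha =>
    ((isBigO_refl (fun n => (w n : ℂ)) F).mul_isLittleO ha).congr_right fun n => by ring
  have LL : ∀ {a : ι → ℂ}, a =o[F] (fun _ => (1 : ℂ)) →
      (fun n => (L n : ℂ) * a n) =o[F] (fun n => (w n : ℂ)) := fun ha =>
    (hL.mul_isLittleO ha).congr_right fun n => by ring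
  have cb : ∀ {a : ι → ℂ}, a =O[F] (fun _ => (1 : ℂ)) →
      (fun n => conj (a n)) =O[F] (fun _ => (1 : ℂ)) := fun {a} ha =>
    (ha.norm_left.congr_left fun n => (RCLike.norm_conj (a n)).symm).of_norm_left
  have co : ∀ {a : ι → ℂ}, a =o[F] (fun _ => (1 : ℂ)) →
      (fun n => conj (a n)) =o[F] (fun _ => (1 : ℂ)) := fun {a} ha =>
    (ha.norm_left.congr_left fun n => (RCLike.norm_conj (a n)).symm).of_norm_left
  have M : ∀ {a b : ι → ℂ}, a =o[F] (fun _ => (1 : ℂ)) → b =O[F] (fun _ => (1 : ℂ)) →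
      (fun n => a n * b n) =o[F] (fun _ => (1 : ℂ)) := fun ha hb =>
    (ha.mul_isBigO hb).congr_right fun n => by ring
  have sq : ∀ {a : ι → ℂ}, (fun n => a n * conj (a n)) =o[F] (fun _ => (1 : ℂ)) →
      a =o[F] (fun _ => (1 : ℂ)) := by
    intro a ha
    refine IsLittleO.of_pow (n := 2) ?_ two_ne_zero
    refine IsLittleO.of_norm_left ((ha.norm_left.congr_left fun n => ?_).congr_right fun n => ?_)
    · simp [pow_two]
    · simp
  have oη : η =o[F] (fun _ => (1 : ℂ)) := isLittleO_one_of_mul_isBigO hw hη.isBigO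
  have oy : y =o[F] (fun _ => (1 : ℂ)) := C1 <|
    of_const_mul (mul_ne_zero hγ' I_ne_zero)
      (((r7.trans hw).sub ((LL oη).const_mul_left I)).sub ((W hη).const_mul_left (k₄ : ℂ)))
      fun n => by ring
  have oz : z =o[F] (fun _ => (1 : ℂ)) := C1 <|
    of_const_mul (mul_ne_zero hk' I_ne_zero)
      (((((LL oy).const_mul_left I).add ((bv.trans_isLittleO hw).const_mul_left (k : ℂ))).add
        ((hη.trans hw).const_mul_left (γ * I))).sub (r4.trans hw)) fun n => by ring
  have ov : v =o[F] (fun _ => (1 : ℂ)) := by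
    apply sq
    -- Multiplier identity: in r4 v̄ + r̄1 y + r̄2 z + r3 ū every term carrying L, and every term
    -- carrying w except the small one with w η, cancels exactly because the speeds agree, leaving
    -- k|v|² plus vanishing terms.
    refine of_const_mul hk' ((((((M r4 (cb bv)).add (M (co r1) by')).add (M (co r2) bz)).add
      (M r3 (cb bu))).sub ((M hη (cb bv)).const_mul_left (γ * I))).add
      ((M oy (cb by')).add (M oy (cb bθ)))) fun n => ?_
    simp only [map_sub, map_mul, conj_I, conj_ofReal]
    ring
  have oθ : θ =o[F] (fun _ => (1 : ℂ)) := by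
    apply sq
    -- The same cancellation for the pairs (v, u) and (φ, θ): r1 θ̄ + r̄6 v + r̄5 u + r2 φ̄ reduces
    -- to -|θ|² - y θ̄ + k|v|².
    refine of_const_mul (c := (-1 : ℂ)) (by norm_num)
      (((((M r1 (cb bθ)).add (M (co r6) bv)).add (M (co r5) bu)).add (M r2 (cb bφ))).add
        ((M oy (cb bθ)).sub ((M ov (cb bv)).const_mul_left (k : ℂ)))) fun n => ?_
    simp only [map_sub, map_add, map_mul, conj_I, conj_ofReal]
    ring
  have ou : u =o[F] (fun _ => (1 : ℂ)) := C1 <|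
    of_const_mul I_ne_zero (((((LL ov).const_mul_left I).sub (oy.trans hw)).sub
      (oθ.trans hw)).sub (r1.trans hw)) fun n => by ring
  have oφ : φ =o[F] (fun _ => (1 : ℂ)) := C1 <|
    of_const_mul (mul_ne_zero hk' I_ne_zero) ((((LL oθ).const_mul_left I).add
      ((ov.trans hw).const_mul_left (k : ℂ))).sub (r6.trans hw)) fun n => by ring
  exact ⟨ov, ou, oz, oy, oφ, oθ, oη⟩

/-- High frequencies, arbitrary wave speeds. -/
theorem ApproxMode.vanishes_of_high
    (h : ApproxMode k₁ k₂ k₃ k₄ γ l (fun n => (w n ^ 4)⁻¹) w L v u z y φ θ η)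
    (hk₁ : k₁ ≠ 0) (hk₂ : k₂ ≠ 0) (hk₃ : k₃ ≠ 0) (hγ : γ ≠ 0)
    (hη : (fun n => w n * η n) =o[(l : Filter ι)] fun n => (w n ^ 2)⁻¹)
    (hw : (fun _ => (1 : ℂ)) =o[(l : Filter ι)] w) :
    Vanishes (l : Filter ι) v u z y φ θ η := by
  set F : Filter ι := (l : Filter ι) with hF
  have hw0 : ∀ᶠ n in F, w n ≠ 0 := by
    filter_upwards [hw.bound one_pos] with n hn h0
    simp [h0] at hn
    linarith
  have P : ∀ (p q : ℕ), p ≤ q → (fun n => w n ^ p * (w n ^ q)⁻¹) =O[F] fun _ => (1 : ℂ) := by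
    intro p q hpq
    refine IsBigO.of_bound 1 ?_
    filter_upwards [hw.bound one_pos, hw0] with n hn h0
    rw [norm_one, one_mul] at hn
    rw [norm_mul, norm_inv, norm_pow, norm_pow, norm_one, mul_one, ← div_eq_mul_inv]
    exact div_le_one_of_le₀ (pow_le_pow_right₀ hn hpq) (by positivity)
  have R : ∀ {a : ι → ℂ} (p q : ℕ), p ≤ q → a =o[F] (fun n => (w n ^ q)⁻¹) →
      (fun n => w n ^ p * a n) =o[F] (fun _ => (1 : ℂ)) := fun p q hpq ha =>
    ((isBigO_refl (fun n => w n ^ p) F).mul_isLittleO ha).trans_isBigO (P p q hpq)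
  have hη2 : (fun n => w n ^ 2 * (w n * η n)) =o[F] (fun _ => (1 : ℂ)) := R 2 2 le_rfl hη
  have hη1 : (fun n => w n ^ 1 * (w n * η n)) =o[F] (fun _ => (1 : ℂ)) := R 1 2 (by norm_num) hη
  have hη0 : (fun n => w n * η n) =o[F] (fun _ => (1 : ℂ)) :=
    (R 0 2 (by norm_num) hη).congr_left fun n => by ring
  rcases isBigO_or_isLittleO (l := l) L w with hL | hL
  swap
  · exact (h.mono ((P 0 4 (by norm_num)).congr_left fun n => by ring)).vanishes_of_elliptic
      hη0 hw hL
  obtain ⟨bv, bu, bz, by', bφ, bθ, bη, r1, r2, r3, r4, r5, r6, r7⟩ := h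
  have r0 : ∀ {a : ι → ℂ}, a =o[F] (fun n => (w n ^ 4)⁻¹) → a =o[F] (fun _ => (1 : ℂ)) :=
    fun ha => (R 0 4 (by norm_num) ha).congr_left fun n => by ring
  have C1 : ∀ {a : ι → ℂ}, (fun n => w n * a n) =o[F] w →
      a =o[F] (fun _ => (1 : ℂ)) := fun ha =>
    IsLittleO.cancel hw0 (ha.congr_right fun n => by ring)
  have LL : ∀ {a : ι → ℂ}, (fun n => w n * a n) =o[F] (fun _ => (1 : ℂ)) →
      (fun n => L n * a n) =o[F] (fun _ => (1 : ℂ)) := fun {a} ha =>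
    (hL.mul (isBigO_refl a F)).trans_isLittleO ha
  have oη : η =o[F] (fun _ => (1 : ℂ)) := isLittleO_one_of_mul_isBigO hw hη0.isBigO
  -- Unequal speeds rule out the multiplier cancellation. The stronger bound on w η compensates: it
  -- gives w² y → 0, so each later equation can afford the loss of powers of w.
  have oy2 : (fun n => w n * (w n * y n)) =o[F] (fun _ => (1 : ℂ)) :=
    of_const_mul (mul_ne_zero hγ I_ne_zero)
      (((R 1 4 (by norm_num) r7).sub ((LL (a := fun n => w n * η n)
        (hη1.congr_left fun n => by ring)).const_mul_left I)).sub
        (hη2.const_mul_left k₄)) fun n => by ring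
  have oy1 : (fun n => w n * y n) =o[F] (fun _ => (1 : ℂ)) :=
    isLittleO_one_of_mul_isBigO hw oy2.isBigO
  have oy : y =o[F] (fun _ => (1 : ℂ)) := isLittleO_one_of_mul_isBigO hw oy1.isBigO
  have oa : (fun n => w n * (I * k₂ * (w n * z n) - k₁ * v n)) =o[F] (fun _ => (1 : ℂ)) :=
    ((((LL oy2).const_mul_left I).add (hη1.const_mul_left (γ * I))).sub
      (R 1 4 (by norm_num) r4)).congr_left fun n => by ring
  have oLz : (fun n => w n * (L n * z n)) =o[F] (fun _ => (1 : ℂ)) :=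
    of_const_mul I_ne_zero ((R 1 4 (by norm_num) r3).add (oy2.const_mul_left I)) fun n => by ring
  have oLv : (fun n => L n * v n) =o[F] (fun _ => (1 : ℂ)) :=
    of_const_mul hk₁ ((oLz.const_mul_left (I * k₂)).sub (LL oa)) fun n => by ring
  have oc : (fun n => I * (w n * u n) + θ n) =o[F] (fun _ => (1 : ℂ)) :=
    (((oLv.const_mul_left I).sub oy).sub (r0 r1)).congr_left fun n => by ring
  have ou : u =o[F] (fun _ => (1 : ℂ)) := isLittleO_one_of_mul_isBigO hw <|
    (isBigO_const_mul_left_iff I_ne_zero).1 ((oc.isBigO.sub bθ).congr_left fun n => by ring)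
  have oz : z =o[F] (fun _ => (1 : ℂ)) := isLittleO_one_of_mul_isBigO hw <|
    (isBigO_const_mul_left_iff (mul_ne_zero I_ne_zero hk₂)).1
      (((isLittleO_one_of_mul_isBigO hw oa.isBigO).isBigO.add (bv.const_mul_left k₁)).congr_left
        fun n => by ring)
  rcases isBigO_or_isLittleO (l := l) w L with hwL | hLw
  · have oWv : (fun n => w n * v n) =o[F] (fun _ => (1 : ℂ)) :=
      (hwL.mul (isBigO_refl v F)).trans_isLittleO oLv
    have ov := isLittleO_one_of_mul_isBigO hw oWv.isBigO
    have oLu : (fun n => L n * u n) =o[F] (fun _ => (1 : ℂ)) :=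
      of_const_mul I_ne_zero ((r0 r2).add (oWv.const_mul_left (I * k₁))) fun n => by ring
    have oWu : (fun n => w n * u n) =o[F] (fun _ => (1 : ℂ)) :=
      (hwL.mul (isBigO_refl u F)).trans_isLittleO oLu
    have oθ : θ =o[F] (fun _ => (1 : ℂ)) :=
      (oc.sub (oWu.const_mul_left I)).congr_left fun n => by ring
    have oLθ : (fun n => L n * θ n) =o[F] w :=
      (hL.mul_isLittleO oθ).congr_right fun n => by ring
    have oφ : φ =o[F] (fun _ => (1 : ℂ)) := C1 <|
      of_const_mul (mul_ne_zero hk₃ I_ne_zero) (((oLθ.const_mul_left I).add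
        ((ov.trans hw).const_mul_left k₁)).sub ((r0 r6).trans hw)) fun n => by ring
    exact ⟨ov, ou, oz, oy, oφ, oθ, oη⟩
  -- When L = o(w), L² stays below the characteristic value k₃ w², so the pair (φ, θ) is elliptic
  -- and vanishes on its own.
  · have hd : (fun n => w n ^ 2) =O[F] fun n => L n ^ 2 - k₃ * w n ^ 2 := by
      have h1 : (fun n => L n ^ 2) =o[F] fun n => k₃ * w n ^ 2 :=
        (isLittleO_const_mul_right_iff hk₃).2 (hLw.pow two_pos)
      exact ((isBigO_const_mul_left_iff hk₃).1 h1.right_isBigO_sub.neg_right).congr_right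
        fun n => by ring
    have T : ∀ {f g : ι → ℂ}, f =O[F] (fun _ => (1 : ℂ)) → (∀ n, f n = I * g n) →
        g =O[F] (fun _ => (1 : ℂ)) := by
      intro f g hf e
      exact (isBigO_const_mul_left_iff I_ne_zero).1 (hf.congr_left e)
    obtain ⟨oφ, oθ⟩ := pair_isLittleO (a := φ) (b := θ) hw hL (isBigO_refl w F) hd
      (T (r0 r5).isBigO fun n => by ring)
      (T ((r0 r6).isBigO.sub (bv.const_mul_left k₁)) fun n => by ring)
    have oWu : (fun n => w n * u n) =o[F] (fun _ => (1 : ℂ)) :=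
      of_const_mul I_ne_zero (oc.sub oθ) fun n => by ring
    have oWv : (fun n => w n * v n) =o[F] (fun _ => (1 : ℂ)) :=
      of_const_mul (mul_ne_zero I_ne_zero hk₁) (((LL oWu).const_mul_left I).sub (r0 r2))
        fun n => by ring
    exact ⟨isLittleO_one_of_mul_isBigO hw oWv.isBigO, ou, oz, oy, oφ, oθ, oη⟩

end Resolvent

end LaminatedBeam

/-! ### The symbol, its dissipation, and the uniform resolvent bound -/

noncomputable section

namespace LaminatedBeam

open Asymptotics Filter Complex
open scoped ComplexConjugate

/-- The symbol of the beam operator at the frequency `ω`: the Fourier transform of the system is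
the family of ordinary differential equations `X' = symbol ω X`. -/
def symbol (k₁ k₂ k₃ k₄ γ ω : ℝ) : State →L[ℂ] State :=
  Matrix.toEuclideanCLM (𝕜 := ℂ) (n := Fin 7)
    ((ω : ℂ) ^ 2 • matA2 k₄ - (I * ω) • matA1 k₁ k₂ k₃ γ 0 1 0 - matA0 k₁)

theorem symbol_apply (k₁ k₂ k₃ k₄ γ ω : ℝ) (x : State) :
    symbol k₁ k₂ k₃ k₄ γ ω x = WithLp.toLp 2 ![
      I * ω * x 1 + x 3 + x 5,
      I * k₁ * ω * x 0,
      I * ω * x 3,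
      I * k₂ * ω * x 2 - k₁ * x 0 - γ * I * ω * x 6,
      I * ω * x 5,
      I * k₃ * ω * x 4 - k₁ * x 0,
      -(k₄ * ω ^ 2 * x 6) - γ * I * ω * x 3] := by
  ext i
  simp only [symbol, Matrix.ofLp_toEuclideanCLM]
  fin_cases i <;>
    simp [matA2, matA1, matA0, Matrix.mulVec, dotProduct, Fin.sum_univ_succ] <;> ring_nf <;> simp

/-- The weights of the energy. -/
def weight (k₁ k₂ k₃ : ℝ) : Fin 7 → ℝ := ![k₁, 1, k₂, 1, k₃, 1, 1]

theorem weight_pos {k₁ k₂ k₃ : ℝ} (hk₁ : 0 < k₁) (hk₂ : 0 < k₂) (hk₃ : 0 < k₃) (i : Fin 7) :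
    0 < weight k₁ k₂ k₃ i := by
  fin_cases i <;> simp [weight, *]

/-- With these weights the first order and zeroth order couplings are skew-adjoint, so only heat
conduction contributes to the real part. -/
theorem weighted_inner_symbol (k₁ k₂ k₃ k₄ γ ω : ℝ) (x : State) :
    (∑ i, (weight k₁ k₂ k₃ i : ℂ) * (conj (x i) * symbol k₁ k₂ k₃ k₄ γ ω x i)).re =
      -(k₄ * ω ^ 2 * ‖x 6‖ ^ 2) := by
  simp only [symbol_apply, weight, Fin.sum_univ_succ, ← Complex.normSq_eq_norm_sq,
    Complex.normSq_apply]
  simp [pow_two]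
  ring

theorem norm_weighted_inner_le {k₁ k₂ k₃ : ℝ} (hk₁ : 0 < k₁) (hk₂ : 0 < k₂) (hk₃ : 0 < k₃)
    (x f : State) :
    ‖∑ i, (weight k₁ k₂ k₃ i : ℂ) * (conj (x i) * f i)‖ ≤
      (∑ i, weight k₁ k₂ k₃ i) * (‖x‖ * ‖f‖) := by
  rw [Finset.sum_mul]
  refine (norm_sum_le _ _).trans (Finset.sum_le_sum fun i _ => ?_)
  have := (weight_pos hk₁ hk₂ hk₃ i)
  rw [norm_mul, norm_mul, RCLike.norm_conj, Complex.norm_real, Real.norm_of_nonneg this.le]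
  gcongr
  · exact PiLp.norm_apply_le x i
  · exact PiLp.norm_apply_le f i

/-- Pairing the resolvent equation with x in the energy inner product, the term iL is purely
imaginary and drops out. This is the only a priori smallness available in the contradiction
argument. -/
theorem dissipation_le {k₁ k₂ k₃ : ℝ} (k₄ γ : ℝ) (hk₁ : 0 < k₁) (hk₂ : 0 < k₂) (hk₃ : 0 < k₃)
    (ω L : ℝ) (x : State) :
    k₄ * ω ^ 2 * ‖x 6‖ ^ 2 ≤ (∑ i, weight k₁ k₂ k₃ i) *
      (‖x‖ * ‖(I * L) • x - symbol k₁ k₂ k₃ k₄ γ ω x‖) := by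
  refine le_trans (le_of_eq ?_) ((Complex.re_le_norm _).trans
    (norm_weighted_inner_le hk₁ hk₂ hk₃ x _))
  rw [← neg_neg (k₄ * ω ^ 2 * ‖x 6‖ ^ 2), ← weighted_inner_symbol k₁ k₂ k₃ k₄ γ]
  have h : (∑ i, (weight k₁ k₂ k₃ i : ℂ) * (conj (x i) * ((I * L) * x i))).re = 0 := by
    rw [Complex.re_sum]
    refine Finset.sum_eq_zero fun i _ => ?_
    simp
    ring_nf
    simp
  simp only [PiLp.sub_apply, PiLp.smul_apply, smul_eq_mul, mul_sub, Finset.sum_sub_distrib,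
    Complex.sub_re] at h ⊢
  rw [h]
  ring

/-- The decay rate of the frequency `ω`: `ω ^ 4` for low frequencies, `|ω| ^ (-q)` for high ones. -/
def rate (q : ℕ) (ω : ℝ) : ℝ := if |ω| ≤ 1 then ω ^ 4 else (|ω| ^ q)⁻¹

theorem rate_nonneg (q : ℕ) (ω : ℝ) : 0 ≤ rate q ω := by
  unfold rate; split_ifs <;> positivity

theorem rate_pos (q : ℕ) {ω : ℝ} (h : ω ≠ 0) : 0 < rate q ω := by
  unfold rate; split_ifs <;> positivity

theorem rate_le_one (q : ℕ) (ω : ℝ) : rate q ω ≤ 1 := by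
  unfold rate
  split_ifs with h
  · calc ω ^ 4 = |ω| ^ 4 := by rw [← abs_pow]; exact (abs_of_nonneg (by positivity)).symm
      _ ≤ 1 := pow_le_one₀ (abs_nonneg _) h
  · exact inv_le_one_of_one_le₀ (one_le_pow₀ (not_le.1 h).le)

/-- Along an ultrafilter the frequencies stay in a compact part of ℝ \ {0}, tend to 0, or diverge;
each regime has its own asymptotic lemma, and `rate` becomes a pure power in the last two. -/
theorem vanishes_of_resolvent {k₁ k₂ k₃ k₄ γ : ℝ} (hk₁ : 0 < k₁) (hk₂ : 0 < k₂) (hk₃ : 0 < k₃)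
    (hγ : 0 < γ) {q : ℕ} (hq : q = 0 ∧ k₁ = k₂ ∧ k₂ = k₃ ∨ q = 4)
    {ι : Type*} {l : Ultrafilter ι} {ω L : ι → ℝ} {v u z y φ θ η : ι → ℂ} (hω : ∀ n, ω n ≠ 0)
    (h : ApproxMode k₁ k₂ k₃ k₄ γ l (fun n => (rate q (ω n) : ℂ)) (fun n => (ω n : ℂ))
      (fun n => (L n : ℂ)) v u z y φ θ η)
    (hη : (fun n => ((ω n : ℂ) * η n) ^ 2) =o[(l : Filter ι)] fun n => (rate q (ω n) : ℂ)) :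
    Vanishes (l : Filter ι) v u z y φ θ η := by
  have ck₁ : (k₁ : ℂ) ≠ 0 := by exact_mod_cast hk₁.ne'
  have ck₂ : (k₂ : ℂ) ≠ 0 := by exact_mod_cast hk₂.ne'
  have ck₃ : (k₃ : ℂ) ≠ 0 := by exact_mod_cast hk₃.ne'
  have cγ : (γ : ℂ) ≠ 0 := by exact_mod_cast hγ.ne'
  have hr : (fun n => (rate q (ω n) : ℂ)) =O[(l : Filter ι)] fun _ => (1 : ℂ) := by
    refine IsBigO.of_bound 1 (Eventually.of_forall fun n => ?_)
    rw [Complex.norm_real, Real.norm_of_nonneg (rate_nonneg _ _)]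
    simpa using rate_le_one q (ω n)
  have hη1 : (fun n => (ω n : ℂ) * η n) =o[(l : Filter ι)] fun _ => (1 : ℂ) :=
    IsLittleO.of_pow (n := 2) ((hη.trans_isBigO hr).congr_right fun n => by simp) two_ne_zero
  rcases isBigO_or_isLittleO (l := l) (fun n => (ω n : ℂ)) (fun _ => 1) with hw | hw
  · rcases isBigO_or_isLittleO (l := l) (fun _ => 1) (fun n => (ω n : ℂ)) with hw' | hw'
    · exact (h.mono hr).vanishes_of_medium ck₁ ck₂ ck₃ cγ hη1 hw hw'
    · have e : (fun n => (rate q (ω n) : ℂ)) =ᶠ[(l : Filter ι)] fun n => (ω n : ℂ) ^ 4 := by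
        filter_upwards [hw'.bound one_pos] with n hn
        rw [Complex.norm_real, norm_one, one_mul, Real.norm_eq_abs] at hn
        simp [rate, hn]
      refine (h.mono e.isBigO).vanishes_of_low ck₁ ck₂ ck₃ cγ ?_ hw'
        (Eventually.of_forall fun n => by exact_mod_cast hω n)
      exact IsLittleO.of_pow (n := 2) ((hη.trans_isBigO e.isBigO).congr_right
        fun n => by simp only [Pi.pow_apply]; ring) two_ne_zero
  · have e : (fun n => (rate q (ω n) : ℂ)) =ᶠ[(l : Filter ι)]
        fun n => (((|ω n| : ℝ) : ℂ) ^ q)⁻¹ := by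
      filter_upwards [hw.bound (half_pos one_pos)] with n hn
      rw [Complex.norm_real, norm_one, Real.norm_eq_abs] at hn
      have : ¬ |ω n| ≤ 1 := by intro h; linarith
      simp [rate, this]
    rcases hq with ⟨rfl, rfl, rfl⟩ | rfl
    · exact (h.mono hr).vanishes_of_high_of_eq hk₁.ne' hγ.ne' hη1 hw
    · have e' : (fun n => (rate 4 (ω n) : ℂ)) =ᶠ[(l : Filter ι)] fun n => ((ω n : ℂ) ^ 4)⁻¹ := by
        refine e.trans (Eventually.of_forall fun n => ?_)
        have : |ω n| ^ 4 = ω n ^ 4 := by rw [← abs_pow]; exact abs_of_nonneg (by positivity)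
        simp only
        exact_mod_cast congrArg (fun r : ℝ => ((r : ℂ))⁻¹) this
      refine (h.mono e'.isBigO).vanishes_of_high ck₁ ck₂ ck₃ cγ ?_ hw
      exact IsLittleO.of_pow (n := 2) ((hη.trans_isBigO e'.isBigO).congr_right
        fun n => by simp only [Pi.pow_apply, inv_pow]; ring) two_ne_zero

/-- The resolvent of the symbol on the imaginary axis is bounded by the inverse of the rate. -/
theorem resolvent_bound {k₁ k₂ k₃ k₄ γ : ℝ} (hk₁ : 0 < k₁) (hk₂ : 0 < k₂) (hk₃ : 0 < k₃)
    (hk₄ : 0 < k₄) (hγ : 0 < γ) {q : ℕ} (hq : q = 0 ∧ k₁ = k₂ ∧ k₂ = k₃ ∨ q = 4) :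
    ∃ C : ℝ, 0 < C ∧ ∀ (ω L : ℝ) (x : State), ω ≠ 0 →
      rate q ω * ‖x‖ ≤ C * ‖(I * L) • x - symbol k₁ k₂ k₃ k₄ γ ω x‖ := by
  by_contra! hcon
  have h1 : ∀ n : ℕ, ∃ (ω L : ℝ) (x : State), ω ≠ 0 ∧ ‖x‖ = 1 ∧
      ‖(I * L) • x - symbol k₁ k₂ k₃ k₄ γ ω x‖ ≤ ((n : ℝ) + 1)⁻¹ * rate q ω := by
    intro n
    obtain ⟨ω, L, x, hω, hx⟩ := hcon (n + 1) (by positivity)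
    have hx0 : x ≠ 0 := by
      rintro rfl
      simp at hx
    have hxn : 0 < ‖x‖ := norm_pos_iff.2 hx0
    refine ⟨ω, L, ((‖x‖ : ℂ)⁻¹) • x, hω, ?_, ?_⟩
    · rw [norm_smul, norm_inv, Complex.norm_real, norm_norm, inv_mul_cancel₀ hxn.ne']
    · rw [map_smul, smul_comm, ← smul_sub, norm_smul, norm_inv, Complex.norm_real, norm_norm,
        inv_mul_le_iff₀ hxn, inv_mul_eq_div, mul_div_assoc', le_div_iff₀ (by positivity)]
      linarith
  choose ω L x hω hx hF using h1
  set F : ℕ → State := fun n => (I * L n) • x n - symbol k₁ k₂ k₃ k₄ γ (ω n) (x n) with hFdef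
  -- An ultrafilter replaces repeated passage to subsequences: any two of the sequences involved are
  -- already comparable along it.
  let l : Ultrafilter ℕ := hyperfilter ℕ
  have hl : (l : Filter ℕ) ≤ atTop := Nat.hyperfilter_le_atTop
  have hFo : F =o[(l : Filter ℕ)] fun n => (rate q (ω n) : ℂ) := by
    rw [isLittleO_iff]
    intro c hc
    have h2 : ∀ᶠ n : ℕ in atTop, ((n : ℝ) + 1)⁻¹ < c :=
      (tendsto_one_div_add_atTop_nhds_zero_nat.congr fun n => one_div _).eventually
        (gt_mem_nhds hc)
    filter_upwards [hl h2] with n hn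
    rw [Complex.norm_real, Real.norm_of_nonneg (rate_nonneg _ _)]
    exact (hF n).trans (mul_le_mul_of_nonneg_right hn.le (rate_nonneg _ _))
  have hb : ∀ i, (fun n => x n i) =O[(l : Filter ℕ)] fun _ => (1 : ℂ) := fun i =>
    IsBigO.of_bound 1 (Eventually.of_forall fun n => by
      simpa [hx n] using PiLp.norm_apply_le (x n) i)
  have hr : ∀ i, (fun n => F n i) =o[(l : Filter ℕ)] fun n => (rate q (ω n) : ℂ) := fun i =>
    (IsBigO.of_bound 1 (Eventually.of_forall fun n => by
      simpa using PiLp.norm_apply_le (F n) i)).trans_isLittleO hFo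
  have hη : (fun n => ((ω n : ℂ) * x n 6) ^ 2) =o[(l : Filter ℕ)]
      fun n => (rate q (ω n) : ℂ) := by
    refine IsBigO.trans_isLittleO (IsBigO.of_bound ((∑ i, weight k₁ k₂ k₃ i) / k₄)
      (Eventually.of_forall fun n => ?_)) hFo
    have h3 := dissipation_le k₄ γ hk₁ hk₂ hk₃ (ω n) (L n) (x n)
    rw [hx n, one_mul] at h3
    rw [norm_pow, norm_mul, Complex.norm_real, mul_pow, Real.norm_eq_abs, sq_abs,
      div_mul_eq_mul_div,
      le_div_iff₀ hk₄]
    calc _ = k₄ * ω n ^ 2 * ‖x n 6‖ ^ 2 := by ring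
      _ ≤ _ := h3
  have hA : ApproxMode k₁ k₂ k₃ k₄ γ (l : Filter ℕ) (fun n => (rate q (ω n) : ℂ))
      (fun n => (ω n : ℂ)) (fun n => (L n : ℂ)) (fun n => x n 0) (fun n => x n 1)
      (fun n => x n 2) (fun n => x n 3) (fun n => x n 4) (fun n => x n 5) (fun n => x n 6) := by
    refine ⟨hb 0, hb 1, hb 2, hb 3, hb 4, hb 5, hb 6, (hr 0).congr_left fun n => ?_,
      (hr 1).congr_left fun n => ?_, (hr 2).congr_left fun n => ?_,
      (hr 3).congr_left fun n => ?_, (hr 4).congr_left fun n => ?_,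
      (hr 5).congr_left fun n => ?_, (hr 6).congr_left fun n => ?_⟩ <;>
    · simp [F, symbol_apply]
      try ring
  obtain ⟨o0, o1, o2, o3, o4, o5, o6⟩ := vanishes_of_resolvent hk₁ hk₂ hk₃ hγ hq hω hA hη
  have ho : ∀ i, Tendsto (fun n => ‖x n i‖ ^ 2) (l : Filter ℕ) (nhds 0) := by
    have key : ∀ i, (fun n => x n i) =o[(l : Filter ℕ)] (fun _ => (1 : ℂ)) →
        Tendsto (fun n => ‖x n i‖ ^ 2) (l : Filter ℕ) (nhds 0) := by
      intro i hi
      have := ((isLittleO_one_iff ℂ).1 hi).norm.pow 2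
      simpa using this
    intro i
    fin_cases i
    exacts [key _ o0, key _ o1, key _ o2, key _ o3, key _ o4, key _ o5, key _ o6]
  have hs : Tendsto (fun n => ∑ i, ‖x n i‖ ^ 2) (l : Filter ℕ) (nhds 0) := by
    simpa using tendsto_finsetSum Finset.univ fun i _ => ho i
  have hs1 : ∀ n, ∑ i, ‖x n i‖ ^ 2 = 1 := by
    intro n
    rw [← EuclideanSpace.norm_sq_eq, hx n, one_pow]
  simp only [hs1] at hs
  exact one_ne_zero (tendsto_nhds_unique tendsto_const_nhds hs)

end LaminatedBeam

end

/-! ### Quantitative Gearhart–Prüss theorem -/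

noncomputable section

namespace LaminatedBeam

open Complex
open scoped FourierTransform ContDiff

section GearhartPruss

variable {H : Type*} [NormedAddCommGroup H] [InnerProductSpace ℂ H] [CompleteSpace H]

theorem fourier_clm_comp (M : H →L[ℂ] H) (f : 𝓢(ℝ, H)) (ξ : ℝ) :
    𝓕 (fun t => M (f t)) ξ = M (𝓕 (f : ℝ → H) ξ) := by
  rw [Real.fourier_eq, Real.fourier_eq, ← ContinuousLinearMap.integral_comp_comm]
  · simp [Circle.smul_def]
  · exact (Real.fourierIntegral_convergent_iff ξ).2 f.integrable

/-- A resolvent bound on the imaginary axis gives a global `L²` bound in time, by Plancherel. -/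
theorem integral_norm_sq_le_of_resolvent (M : H →L[ℂ] H) {R : ℝ}
    (hR : ∀ (L : ℝ) (x : H), ‖x‖ ≤ R * ‖(I * L) • x - M x‖) (f g : 𝓢(ℝ, H))
    (hfg : ∀ t, deriv f t = M (f t) + g t) :
    ∫ t, ‖f t‖ ^ 2 ≤ R ^ 2 * ∫ t, ‖g t‖ ^ 2 := by
  rw [← SchwartzMap.integral_norm_sq_fourier f, ← SchwartzMap.integral_norm_sq_fourier g,
    ← integral_const_mul]
  have hi : ∀ h : 𝓢(ℝ, H), Integrable fun t => ‖h t‖ ^ 2 := fun h =>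
    (memLp_two_iff_integrable_sq_norm h.continuous.aestronglyMeasurable).1 (h.memLp 2)
  refine integral_mono (hi _) ((hi _).const_mul _) fun ξ => ?_
  -- The time Fourier transform turns f' = Mf + g into a resolvent equation with L = 2πξ, to which
  -- the hypothesis applies pointwise.
  have key : 𝓕 g ξ = (I * ((2 * Real.pi * ξ : ℝ) : ℂ)) • 𝓕 f ξ - M (𝓕 f ξ) := by
    have h1 : 𝓕 (deriv f) ξ = (2 * Real.pi * I * ξ) • 𝓕 (f : ℝ → H) ξ := by
      rw [Real.fourier_deriv f.integrable f.differentiable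
        (SchwartzMap.derivCLM ℂ H f).integrable]
    have h2 : (deriv f : ℝ → H) = (fun t => M (f t)) + (g : ℝ → H) := funext hfg
    have h3 : 𝓕 ((fun t => M (f t)) + (g : ℝ → H)) ξ
        = 𝓕 (fun t => M (f t)) ξ + 𝓕 (g : ℝ → H) ξ := by
      simp only [Real.fourier_eq, Pi.add_apply, smul_add]
      exact integral_add ((Real.fourierIntegral_convergent_iff ξ).2
        (M.integrable_comp f.integrable)) ((Real.fourierIntegral_convergent_iff ξ).2 g.integrable)
    rw [h2, h3, fourier_clm_comp] at h1
    rw [SchwartzMap.fourier_coe, SchwartzMap.fourier_coe, eq_sub_iff_add_eq', h1]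
    congr 1
    push_cast
    ring
  have := hR (2 * Real.pi * ξ) (𝓕 f ξ)
  rw [← key] at this
  simp only
  rw [← mul_pow]
  exact pow_le_pow_left₀ (norm_nonneg _) this 2

theorem hasDerivAt_exp_smul_apply (M : H →L[ℂ] H) (x : H) (t : ℝ) :
    HasDerivAt (fun s : ℝ => NormedSpace.exp (s • M) x) (M (NormedSpace.exp (t • M) x)) t := by
  have h := (hasDerivAt_exp_smul_const' (𝕂 := ℝ) M t).hasFDerivAt
  have h2 := ((ContinuousLinearMap.apply ℂ H x).restrictScalars ℝ).hasFDerivAt.comp t h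
  simpa [Function.comp_def] using h2.hasDerivAt

theorem contDiff_exp : ContDiff ℝ ∞ (NormedSpace.exp : (H →L[ℂ] H) → (H →L[ℂ] H)) :=
  AnalyticOnNhd.contDiff fun y _ => NormedSpace.exp_analytic (𝕂 := ℝ) y

omit [CompleteSpace H] in
theorem contDiff_clm_apply {f : ℝ → H →L[ℂ] H} (hf : ContDiff ℝ ∞ f) (x : H) :
    ContDiff ℝ ∞ fun s => f s x :=
  ((ContinuousLinearMap.apply ℂ H x).restrictScalars ℝ).contDiff.comp hf

theorem contDiff_exp_smul_apply (M : H →L[ℂ] H) (x : H) :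
    ContDiff ℝ ∞ fun s : ℝ => NormedSpace.exp (s • M) x := by
  exact contDiff_clm_apply (contDiff_exp.comp (contDiff_id.smul contDiff_const)) x

theorem exp_zero_smul_apply (M : H →L[ℂ] H) (x : H) :
    NormedSpace.exp ((0 : ℝ) • M) x = x := by
  rw [zero_smul, NormedSpace.exp_zero]
  rfl

theorem exp_add_smul_apply (M : H →L[ℂ] H) (x : H) (s t : ℝ) :
    NormedSpace.exp ((s + t) • M) x = NormedSpace.exp (s • M) (NormedSpace.exp (t • M) x) := by
  let _ : NormedAlgebra ℚ (H →L[ℂ] H) := NormedAlgebra.restrictScalars ℚ ℝ _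
  rw [add_smul, NormedSpace.exp_add_of_commute]
  · rfl
  · exact ((Commute.refl M).smul_left s).smul_right t

/-- A fixed time after which a bounded semigroup has lost half of its norm, in terms of the
resolvent bound. -/
theorem exists_half_time {K : ℝ} (hK : 1 ≤ K) :
    ∃ a : ℝ, 0 < a ∧ ∀ (M : H →L[ℂ] H) (R : ℝ), 0 < R →
      (∀ t : ℝ, 0 ≤ t → ∀ x, ‖NormedSpace.exp (t • M) x‖ ≤ K * ‖x‖) →
      (∀ (L : ℝ) (x : H), ‖x‖ ≤ R * ‖(I * L) • x - M x‖) →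
      ∀ x, ‖NormedSpace.exp ((a * R) • M) x‖ ≤ 1 / 2 * ‖x‖ := by
  -- Equal to 1 on [1, 2] and supported in [0, 3]; truncating the orbit with χ(t/T) makes it
  -- Schwartz, at the price of the source χ'(t/T)/T · X.
  let χ : ContDiffBump (3 / 2 : ℝ) := ⟨1 / 2, 3 / 2, by norm_num, by norm_num⟩
  have hχs : ∀ t, t ∉ Set.Ioo (0 : ℝ) 3 → χ t = 0 := by
    intro t ht
    apply χ.zero_of_le_dist
    rw [Real.dist_eq]
    by_contra! h
    rw [abs_lt] at h
    exact ht ⟨by simp only [χ] at h; linarith, by simp only [χ] at h; linarith⟩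
  have hχ1 : ∀ t ∈ Set.Icc (1 : ℝ) 2, χ t = 1 := by
    intro t ht
    apply χ.one_of_mem_closedBall
    rw [Metric.mem_closedBall, Real.dist_eq, abs_le]
    simp only [χ]
    constructor <;> linarith [ht.1, ht.2]
  have hχd : ContDiff ℝ ∞ χ := χ.contDiff
  have hcd : Continuous (deriv χ) := hχd.continuous_deriv (by simp)
  obtain ⟨B, hB⟩ := hcd.bounded_above_of_compact_support χ.hasCompactSupport.deriv
  have hχs' : ∀ t, t ∉ Set.Icc (0 : ℝ) 3 → deriv χ t = 0 := by
    intro t ht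
    have h1 : χ =ᶠ[nhds t] fun _ => 0 := by
      filter_upwards [isClosed_Icc.isOpen_compl.mem_nhds ht] with s hs
      exact hχs s fun h => hs (Set.Ioo_subset_Icc_self h)
    rw [h1.deriv_eq, deriv_const]
  have hB0 : 0 ≤ B := (norm_nonneg _).trans (hB 0)
  -- Comparing the two integrals gives T‖X(2T)‖ ≤ √3 R B K²‖x‖. With T = bR this choice makes R B K²
  -- ≤ T/4, and √3/4 < 1/2. Since B belongs to a fixed cutoff, b depends on K alone.
  set b : ℝ := 4 * (B + 1) * K ^ 2 with hb
  have hb0 : 0 < b := by positivity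
  refine ⟨2 * b, by positivity, fun M R hR hM hres x => ?_⟩
  set X : ℝ → H := fun s => NormedSpace.exp (s • M) x with hX
  have hXd : ContDiff ℝ ∞ X := contDiff_exp_smul_apply M x
  set T : ℝ := b * R with hT
  have hT0 : 0 < T := by positivity
  have hf1 : ContDiff ℝ ∞ fun t : ℝ => χ (t / T) • X t :=
    (hχd.comp (contDiff_id.div_const T)).smul hXd
  have hg1 : ContDiff ℝ ∞ fun t : ℝ => (deriv χ (t / T) / T) • X t := by
    have : ContDiff ℝ ∞ (deriv χ) := (contDiff_infty_iff_deriv.1 hχd).2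
    exact ((this.comp (contDiff_id.div_const T)).div_const T).smul hXd
  have hmem : ∀ t, t ∉ Set.Icc 0 (3 * T) → t / T ∉ Set.Icc (0 : ℝ) 3 := by
    intro t ht h
    exact ht ⟨by have := mul_nonneg h.1 hT0.le; rwa [div_mul_cancel₀ _ hT0.ne'] at this,
      (div_le_iff₀ hT0).1 h.2⟩
  have hf2 : HasCompactSupport fun t : ℝ => χ (t / T) • X t :=
    HasCompactSupport.intro (isCompact_Icc (a := 0) (b := 3 * T)) fun t ht => by
      rw [hχs _ fun h => hmem t ht (Set.Ioo_subset_Icc_self h), zero_smul]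
  have hg2 : HasCompactSupport fun t : ℝ => (deriv χ (t / T) / T) • X t :=
    HasCompactSupport.intro (isCompact_Icc (a := 0) (b := 3 * T)) fun t ht => by
      rw [hχs' _ (hmem t ht), zero_div, zero_smul]
  have main := integral_norm_sq_le_of_resolvent M hres (hf2.toSchwartzMap hf1)
    (hg2.toSchwartzMap hg1) (fun t => by
      have h1 : HasDerivAt (fun t : ℝ => χ (t / T)) (deriv χ (t / T) / T) t := by
        have h2 := (hχd.differentiable (by simp) (t / T)).hasDerivAt
        have := h2.comp t ((hasDerivAt_id t).div_const T)
        simpa [div_eq_mul_inv, Function.comp_def] using this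
      have h2 := (h1.smul (hasDerivAt_exp_smul_apply M x t)).deriv
      change deriv (fun t : ℝ => χ (t / T) • X t) t =
        M (χ (t / T) • X t) + (deriv χ (t / T) / T) • X t
      rw [M.map_smul_of_tower]
      exact h2)
  change ∫ t, ‖χ (t / T) • X t‖ ^ 2 ≤ R ^ 2 * ∫ t, ‖(deriv χ (t / T) / T) • X t‖ ^ 2 at main
  have hi : ∀ h : 𝓢(ℝ, H), Integrable fun t => ‖h t‖ ^ 2 := fun h =>
    (memLp_two_iff_integrable_sq_norm h.continuous.aestronglyMeasurable).1 (h.memLp 2)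
  have hfi : Integrable fun t => ‖χ (t / T) • X t‖ ^ 2 := hi (hf2.toSchwartzMap hf1)
  have hgi : Integrable fun t => ‖(deriv χ (t / T) / T) • X t‖ ^ 2 := hi (hg2.toSchwartzMap hg1)
  have hK0 : 0 < K := by linarith
  have low : T * (‖X (2 * T)‖ / K) ^ 2 ≤ ∫ t, ‖χ (t / T) • X t‖ ^ 2 := by
    calc T * (‖X (2 * T)‖ / K) ^ 2 = ∫ t in Set.Icc T (2 * T), (‖X (2 * T)‖ / K) ^ 2 := by
          rw [setIntegral_const, Measure.real, Real.volume_Icc,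
            ENNReal.toReal_ofReal (by linarith), smul_eq_mul]
          ring
      _ ≤ ∫ t in Set.Icc T (2 * T), ‖χ (t / T) • X t‖ ^ 2 := by
          refine setIntegral_mono_on (integrableOn_const measure_Icc_lt_top.ne) hfi.integrableOn
            measurableSet_Icc fun t ht => ?_
          rw [hχ1 _ ⟨(le_div_iff₀ hT0).2 (by linarith [ht.1]),
            (div_le_iff₀ hT0).2 ht.2⟩, one_smul]
          refine pow_le_pow_left₀ (by positivity) ?_ 2
          rw [div_le_iff₀ hK0]
          have h3 : X (2 * T) = NormedSpace.exp ((2 * T - t) • M) (X t) := by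
            rw [hX, ← exp_add_smul_apply, sub_add_cancel]
          rw [h3]
          exact (hM (2 * T - t) (by linarith [ht.2]) (X t)).trans_eq (mul_comm _ _)
      _ ≤ _ := setIntegral_le_integral hfi (Filter.Eventually.of_forall fun t => by positivity)
  have up : ∫ t, ‖(deriv χ (t / T) / T) • X t‖ ^ 2 ≤ 3 * T * (B / T * (K * ‖x‖)) ^ 2 := by
    calc ∫ t, ‖(deriv χ (t / T) / T) • X t‖ ^ 2
        = ∫ t in Set.Icc 0 (3 * T), ‖(deriv χ (t / T) / T) • X t‖ ^ 2 := by
          rw [setIntegral_eq_integral_of_forall_compl_eq_zero]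
          intro t ht
          rw [hχs' _ (hmem t ht), zero_div, zero_smul, norm_zero, zero_pow two_ne_zero]
      _ ≤ ∫ t in Set.Icc 0 (3 * T), (B / T * (K * ‖x‖)) ^ 2 := by
          refine setIntegral_mono_on hgi.integrableOn (integrableOn_const measure_Icc_lt_top.ne)
            measurableSet_Icc fun t ht => ?_
          refine pow_le_pow_left₀ (by positivity) ?_ 2
          rw [norm_smul, norm_div, Real.norm_of_nonneg hT0.le]
          gcongr
          · exact hB _
          · exact hM t ht.1 x
      _ = _ := by
          rw [setIntegral_const, Measure.real, Real.volume_Icc,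
            ENNReal.toReal_ofReal (by linarith), smul_eq_mul, sub_zero]
  have fin := (low.trans main).trans (mul_le_mul_of_nonneg_left up (sq_nonneg R))
  have e1 : (2 * b * R) = 2 * T := by rw [hT]; ring
  rw [e1]
  change ‖X (2 * T)‖ ≤ _
  refine le_of_sq_le_sq ?_ (by positivity)
  have fin2 : (T * ‖X (2 * T)‖) ^ 2 ≤ 3 * (R * B * K ^ 2 * ‖x‖) ^ 2 := by
    have := mul_le_mul_of_nonneg_left fin (by positivity : 0 ≤ T * K ^ 2)
    have e2 : T * K ^ 2 * (T * (‖X (2 * T)‖ / K) ^ 2) = (T * ‖X (2 * T)‖) ^ 2 := by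
      field_simp
    have e3 : T * K ^ 2 * (R ^ 2 * (3 * T * (B / T * (K * ‖x‖)) ^ 2)) =
        3 * (R * B * K ^ 2 * ‖x‖) ^ 2 := by
      field_simp
    rwa [e2, e3] at this
  have e4 : (R * B * K ^ 2 * ‖x‖) ≤ T * ‖x‖ / 4 := by
    have : T * ‖x‖ / 4 = R * (B + 1) * K ^ 2 * ‖x‖ := by rw [hT, hb]; ring
    rw [this]
    gcongr
    linarith
  have e5 : (R * B * K ^ 2 * ‖x‖) ^ 2 ≤ (T * ‖x‖ / 4) ^ 2 :=
    pow_le_pow_left₀ (by positivity) e4 2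
  have e6 : T ^ 2 * ‖X (2 * T)‖ ^ 2 ≤ T ^ 2 * (1 / 2 * ‖x‖) ^ 2 := by
    nlinarith [sq_nonneg (T * ‖x‖)]
  exact le_of_mul_le_mul_left e6 (by positivity)

/-- **Quantitative Gearhart–Prüss theorem**: a bounded semigroup decays exponentially at a rate
proportional to the inverse of the resolvent bound on the imaginary axis. -/
theorem exp_decay_of_resolvent {K : ℝ} (hK : 1 ≤ K) :
    ∃ c : ℝ, 0 < c ∧ ∀ (M : H →L[ℂ] H) (R : ℝ), 0 < R →
      (∀ t : ℝ, 0 ≤ t → ∀ x, ‖NormedSpace.exp (t • M) x‖ ≤ K * ‖x‖) →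
      (∀ (L : ℝ) (x : H), ‖x‖ ≤ R * ‖(I * L) • x - M x‖) →
      ∀ t : ℝ, 0 ≤ t → ∀ x,
        ‖NormedSpace.exp (t • M) x‖ ≤ 2 * K * Real.exp (-(c * t / R)) * ‖x‖ := by
  obtain ⟨a, ha, h⟩ := exists_half_time (H := H) hK
  refine ⟨Real.log 2 / a, div_pos (Real.log_pos one_lt_two) ha, ?_⟩
  intro M R hR hM hres t ht x
  have hτ : 0 < a * R := mul_pos ha hR
  have hn : ∀ n : ℕ, ∀ x, ‖NormedSpace.exp ((n * (a * R)) • M) x‖ ≤ (1 / 2) ^ n * ‖x‖ := by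
    intro n
    induction n with
    | zero => intro x; simp
    | succ n ih =>
      intro x
      rw [Nat.cast_succ, add_mul, one_mul, exp_add_smul_apply]
      refine (ih _).trans ?_
      rw [pow_succ, mul_assoc]
      exact mul_le_mul_of_nonneg_left (h M R hR hM hres x) (by positivity)
  set n := ⌊t / (a * R)⌋₊ with hnd
  have h1 : (n : ℝ) * (a * R) ≤ t := by
    rw [← le_div_iff₀ hτ]
    exact Nat.floor_le (by positivity)
  have h2 : t / (a * R) < n + 1 := Nat.lt_floor_add_one _
  have h3 : NormedSpace.exp (t • M) x = NormedSpace.exp ((t - n * (a * R)) • M)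
      (NormedSpace.exp ((n * (a * R)) • M) x) := by
    rw [← exp_add_smul_apply, sub_add_cancel]
  rw [h3]
  refine (hM _ (by linarith) _).trans ?_
  -- The factor 2 pays for the incomplete last period: t/(aR) < n + 1, not n.
  have h4 : (1 / 2 : ℝ) ^ n ≤ 2 * Real.exp (-(Real.log 2 / a * t / R)) := by
    have e1 : (1 / 2 : ℝ) ^ n = 2 * Real.exp (-(Real.log 2 * (n + 1))) := by
      rw [mul_comm, Real.exp_neg, Real.exp_mul, Real.exp_log two_pos]
      rw [← Nat.cast_succ, Real.rpow_natCast, pow_succ, one_div, inv_pow]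
      field_simp
    rw [e1]
    gcongr
    rw [div_mul_eq_mul_div, div_div, mul_div_assoc]
    exact mul_le_mul_of_nonneg_left h2.le (Real.log_nonneg one_le_two)
  calc K * ‖NormedSpace.exp ((n * (a * R)) • M) x‖ ≤ K * ((1 / 2) ^ n * ‖x‖) := by
        gcongr; exact hn n x
    _ ≤ K * (2 * Real.exp (-(Real.log 2 / a * t / R)) * ‖x‖) := by gcongr
    _ = _ := by ring

end GearhartPruss

end LaminatedBeam

end

/-! ### Uniform decay of the evolution at each frequency -/

noncomputable section

namespace LaminatedBeam

open Complex
open scoped ComplexConjugate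

theorem sum_weight_pos {k₁ k₂ k₃ : ℝ} (hk₁ : 0 < k₁) (hk₂ : 0 < k₂) (hk₃ : 0 < k₃) :
    0 < ∑ i, weight k₁ k₂ k₃ i :=
  Finset.sum_pos (fun i _ => weight_pos hk₁ hk₂ hk₃ i) Finset.univ_nonempty

/-- The energy of a state does not increase along the evolution. -/
theorem antitone_energy {k₁ k₂ k₃ k₄ : ℝ} (γ : ℝ) (hk₄ : 0 < k₄) (ω : ℝ) (x : State) :
    Antitone fun t : ℝ => ∑ i, weight k₁ k₂ k₃ i *
      ‖NormedSpace.exp (t • symbol k₁ k₂ k₃ k₄ γ ω) x i‖ ^ 2 := by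
  set M := symbol k₁ k₂ k₃ k₄ γ ω with hM
  set X : ℝ → State := fun t => NormedSpace.exp (t • M) x with hX
  have hd : ∀ t i, HasDerivAt (fun t => X t i) (M (X t) i) t := by
    intro t i
    exact (hasDerivAt_pi.1 ((PiLp.continuousLinearEquiv 2 ℝ
      (fun _ : Fin 7 => ℂ)).toContinuousLinearMap.hasFDerivAt.comp_hasDerivAt t
        (hasDerivAt_exp_smul_apply M x t))) i
  have hE : ∀ t, HasDerivAt (fun t => ∑ i, weight k₁ k₂ k₃ i * ‖X t i‖ ^ 2)
      (∑ i, weight k₁ k₂ k₃ i * (2 * inner ℝ (X t i) (M (X t) i))) t := fun t =>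
    HasDerivAt.fun_sum fun i _ => ((hd t i).norm_sq).const_mul _
  refine antitone_of_deriv_nonpos (fun t => (hE t).differentiableAt) fun t => ?_
  rw [(hE t).deriv]
  have h1 := weighted_inner_symbol k₁ k₂ k₃ k₄ γ ω (X t)
  have h2 : ∑ i, weight k₁ k₂ k₃ i * (2 * inner ℝ (X t i) (M (X t) i)) =
      2 * (∑ i, (weight k₁ k₂ k₃ i : ℂ) * (conj (X t i) * M (X t) i)).re := by
    rw [Complex.re_sum, Finset.mul_sum]
    refine Finset.sum_congr rfl fun i _ => ?_
    rw [Complex.re_ofReal_mul, Complex.inner, mul_comm (M (X t) i)]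
    ring
  rw [h2, h1]
  have : 0 ≤ k₄ * ω ^ 2 * ‖X t 6‖ ^ 2 := by positivity
  linarith

theorem exists_norm_exp_symbol_le {k₁ k₂ k₃ k₄ : ℝ} (γ : ℝ) (hk₁ : 0 < k₁) (hk₂ : 0 < k₂)
    (hk₃ : 0 < k₃) (hk₄ : 0 < k₄) :
    ∃ K : ℝ, 1 ≤ K ∧ ∀ (ω t : ℝ), 0 ≤ t → ∀ x,
      ‖NormedSpace.exp (t • symbol k₁ k₂ k₃ k₄ γ ω) x‖ ≤ K * ‖x‖ := by
  obtain ⟨m, hm, hmw⟩ : ∃ m : ℝ, 0 < m ∧ ∀ i, m ≤ weight k₁ k₂ k₃ i := by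
    obtain ⟨i, hi⟩ := Finite.exists_min (weight k₁ k₂ k₃)
    exact ⟨_, weight_pos hk₁ hk₂ hk₃ i, hi⟩
  set S := ∑ i, weight k₁ k₂ k₃ i with hS
  have hS0 : 0 < S := sum_weight_pos hk₁ hk₂ hk₃
  have hw : ∀ i, weight k₁ k₂ k₃ i ≤ S := fun i =>
    Finset.single_le_sum (fun j _ => (weight_pos hk₁ hk₂ hk₃ j).le) (Finset.mem_univ i)
  -- The natural constant is √(S/m); 1 + S/m is at least 1 and its square dominates S/m. Neither
  -- depends on ω.
  refine ⟨1 + S / m, by simp; positivity, fun ω t ht x => ?_⟩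
  set X := NormedSpace.exp (t • symbol k₁ k₂ k₃ k₄ γ ω) x with hX
  have h1 : m * ‖X‖ ^ 2 ≤ ∑ i, weight k₁ k₂ k₃ i * ‖X i‖ ^ 2 := by
    rw [EuclideanSpace.norm_sq_eq, Finset.mul_sum]
    exact Finset.sum_le_sum fun i _ => mul_le_mul_of_nonneg_right (hmw i) (by positivity)
  have h2 : ∑ i, weight k₁ k₂ k₃ i * ‖x i‖ ^ 2 ≤ S * ‖x‖ ^ 2 := by
    rw [EuclideanSpace.norm_sq_eq, Finset.mul_sum]
    exact Finset.sum_le_sum fun i _ => mul_le_mul_of_nonneg_right (hw i) (by positivity)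
  have h3 := antitone_energy (k₁ := k₁) (k₂ := k₂) (k₃ := k₃) γ hk₄ ω x ht
  simp only [exp_zero_smul_apply] at h3
  have h4 : ‖X‖ ^ 2 ≤ S / m * ‖x‖ ^ 2 := by
    rw [div_mul_eq_mul_div, le_div_iff₀ hm]
    linarith
  refine le_of_sq_le_sq ?_ (by positivity)
  refine h4.trans ?_
  rw [mul_pow]
  gcongr
  nlinarith [div_pos hS0 hm]

/-- The evolution at the frequency `ω` decays at the rate `rate q ω`. -/
theorem exists_norm_exp_symbol_le_rate {k₁ k₂ k₃ k₄ γ : ℝ} (hk₁ : 0 < k₁) (hk₂ : 0 < k₂)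
    (hk₃ : 0 < k₃) (hk₄ : 0 < k₄) (hγ : 0 < γ) {q : ℕ}
    (hq : q = 0 ∧ k₁ = k₂ ∧ k₂ = k₃ ∨ q = 4) :
    ∃ K c : ℝ, 1 ≤ K ∧ 0 < c ∧ ∀ (ω t : ℝ), 0 ≤ t → ∀ x,
      ‖NormedSpace.exp (t • symbol k₁ k₂ k₃ k₄ γ ω) x‖ ≤
        K * Real.exp (-(c * rate q ω * t)) * ‖x‖ := by
  obtain ⟨K, hK, hb⟩ := exists_norm_exp_symbol_le γ hk₁ hk₂ hk₃ hk₄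
  obtain ⟨c, hc, hdecay⟩ := exp_decay_of_resolvent (H := State) hK
  obtain ⟨C, hC, hres⟩ := resolvent_bound hk₁ hk₂ hk₃ hk₄ hγ hq
  refine ⟨2 * K, c / C, by linarith, by positivity, fun ω t ht x => ?_⟩
  -- The rate vanishes at ω = 0, where only boundedness is claimed; elsewhere the resolvent constant
  -- is R = C / rate.
  rcases eq_or_ne ω 0 with rfl | hω
  · refine (hb 0 t ht x).trans ?_
    have : rate q 0 = 0 := by simp [rate]
    rw [this, mul_zero, zero_mul, neg_zero, Real.exp_zero, mul_one]
    gcongr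
    linarith
  · have hr := rate_pos q hω
    have := hdecay (symbol k₁ k₂ k₃ k₄ γ ω) (C / rate q ω) (by positivity) (hb ω)
      (fun L x => by
        rw [div_mul_eq_mul_div, le_div_iff₀ hr, mul_comm]
        exact hres ω L x hω) t ht x
    refine this.trans (le_of_eq ?_)
    congr 3
    field_simp

open scoped ContDiff in
theorem contDiff_symbol (k₁ k₂ k₃ k₄ γ : ℝ) : ContDiff ℝ ∞ (symbol k₁ k₂ k₃ k₄ γ) := by
  have h : symbol k₁ k₂ k₃ k₄ γ = fun ξ : ℝ =>
      (ξ ^ 2) • Matrix.toEuclideanCLM (𝕜 := ℂ) (n := Fin 7) (matA2 k₄) -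
      ξ • (I • Matrix.toEuclideanCLM (𝕜 := ℂ) (n := Fin 7) (matA1 k₁ k₂ k₃ γ 0 1 0)) -
      Matrix.toEuclideanCLM (𝕜 := ℂ) (n := Fin 7) (matA0 k₁) := by
    ext1 ξ
    simp only [symbol, map_sub, map_smul, mul_comm I, mul_smul]
    norm_cast
  rw [h]
  fun_prop

end LaminatedBeam

end

/-! ### Pairings with operator valued test functions -/

noncomputable section

namespace LaminatedBeam

open Complex Filter
open scoped FourierTransform ContDiff BoundedContinuousFunction

section Pairing

variable {H : Type*} [NormedAddCommGroup H] [InnerProductSpace ℂ H]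

theorem integrable_clm_apply {A : ℝ → (H →L[ℂ] H)} (hA : Continuous A) (hA' : HasCompactSupport A)
    {V : ℝ → H} (hV : LocallyIntegrable V) : Integrable fun ξ => A ξ (V ξ) := by
  have h1 : Integrable fun ξ => ‖A ξ‖ • V ξ :=
    hV.integrable_smul_left_of_hasCompactSupport hA.norm hA'.norm
  refine h1.mono ((ContinuousLinearMap.id ℂ (H →L[ℂ] H)).aestronglyMeasurable_comp₂
    hA.aestronglyMeasurable hV.aestronglyMeasurable) (Eventually.of_forall fun ξ => ?_)
  rw [norm_smul, norm_norm]
  exact (A ξ).le_opNorm _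

omit [InnerProductSpace ℂ H] in
theorem locallyIntegrable_lp (V : Lp H 2 (volume : Measure ℝ)) : LocallyIntegrable V :=
  (Lp.memLp V).locallyIntegrable (by norm_num)

theorem norm_sq_eq_integral (V : Lp H 2 (volume : Measure ℝ)) : ‖V‖ ^ 2 = ∫ ξ, ‖V ξ‖ ^ 2 := by
  rw [← @inner_self_eq_norm_sq ℂ, L2.inner_def]
  simp only [inner_self_eq_norm_sq_to_K]
  norm_cast

theorem integral_abs_mul_norm_le {φ : ℝ → ℝ} (hφ : Continuous φ) (hφ' : HasCompactSupport φ)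
    (V : Lp H 2 (volume : Measure ℝ)) :
    ∫ ξ, ‖φ ξ‖ * ‖V ξ‖ ≤ (∫ ξ, ‖φ ξ‖ ^ 2) ^ (1 / 2 : ℝ) * ‖V‖ := by
  have h := integral_mul_norm_le_Lp_mul_Lq (μ := volume) (f := φ)
    (g := fun ξ => ‖V ξ‖) (p := 2) (q := 2) (by constructor <;> norm_num)
    (by simpa using hφ.memLp_of_hasCompactSupport (p := 2) hφ') (by simpa using (Lp.memLp V).norm)
  simp only [norm_norm] at h
  refine h.trans (le_of_eq ?_)
  have e : ‖V‖ = (∫ ξ, ‖V ξ‖ ^ (2 : ℝ)) ^ (1 / 2 : ℝ) := by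
    rw [← Real.sqrt_eq_rpow, ← Real.sqrt_sq (norm_nonneg V), norm_sq_eq_integral]
    norm_cast
  rw [e]
  norm_cast

/-- The pairing `(A, V) ↦ ∫ φ A V` as a bounded bilinear map. -/
def testPairing {φ : ℝ → ℝ} (hφ : Continuous φ) (hφ' : HasCompactSupport φ) :
    (ℝ →ᵇ (H →L[ℂ] H)) →L[ℝ] (Lp H 2 (volume : Measure ℝ)) →L[ℝ] H :=
  have hi : ∀ (A : ℝ →ᵇ (H →L[ℂ] H)) (V : Lp H 2 (volume : Measure ℝ)),
      Integrable fun ξ => φ ξ • A ξ (V ξ) := fun A V =>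
    integrable_clm_apply (A := fun ξ => φ ξ • A ξ) (hφ.smul A.continuous) hφ'.smul_right
      (locallyIntegrable_lp V)
  LinearMap.mkContinuous₂
    (LinearMap.mk₂ ℝ (fun (A : ℝ →ᵇ (H →L[ℂ] H)) (V : Lp H 2 (volume : Measure ℝ)) =>
        ∫ ξ, φ ξ • A ξ (V ξ))
      (fun A B V => by
        rw [← integral_add (hi A V) (hi B V)]
        exact integral_congr_ae (Eventually.of_forall fun ξ => by simp [smul_add]))
      (fun c A V => by
        rw [← integral_smul]
        exact integral_congr_ae (Eventually.of_forall fun ξ => by simp [smul_comm c]))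
      (fun A V W => by
        rw [← integral_add (hi A V) (hi A W)]
        refine integral_congr_ae ?_
        filter_upwards [Lp.coeFn_add V W] with ξ h
        rw [h, Pi.add_apply, map_add, smul_add])
      (fun c A V => by
        rw [← integral_smul]
        refine integral_congr_ae ?_
        filter_upwards [Lp.coeFn_smul c V] with ξ h
        rw [h, Pi.smul_apply, (A ξ).map_smul_of_tower, smul_comm]))
    ((∫ ξ, ‖φ ξ‖ ^ 2) ^ (1 / 2 : ℝ))
    (fun A V => by
      have hint : Integrable fun ξ => ‖φ ξ‖ * ‖V ξ‖ := by
        have := ((locallyIntegrable_lp V).integrable_smul_left_of_hasCompactSupport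
          hφ hφ').norm
        simpa [norm_smul] using this
      calc ‖∫ ξ, φ ξ • A ξ (V ξ)‖ ≤ ∫ ξ, ‖A‖ * (‖φ ξ‖ * ‖V ξ‖) := by
            refine norm_integral_le_of_norm_le (hint.const_mul _) (Eventually.of_forall fun ξ => ?_)
            rw [norm_smul, mul_left_comm]
            gcongr
            exact ((A ξ).le_opNorm _).trans (by gcongr; exact A.norm_coe_le_norm ξ)
        _ ≤ ‖A‖ * ((∫ ξ, ‖φ ξ‖ ^ 2) ^ (1 / 2 : ℝ) * ‖V‖) := by
            rw [integral_const_mul]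
            gcongr
            exact integral_abs_mul_norm_le hφ hφ' V
        _ = _ := by ring)

theorem testPairing_apply {φ : ℝ → ℝ} (hφ : Continuous φ) (hφ' : HasCompactSupport φ)
    (A : ℝ →ᵇ (H →L[ℂ] H)) (V : Lp H 2 (volume : Measure ℝ)) :
    testPairing hφ hφ' A V = ∫ ξ, φ ξ • A ξ (V ξ) := rfl

/-- Evaluation at ξ is a continuous ring homomorphism, so it commutes with the exponential series.
-/
theorem exp_bcf_apply {𝔹 : Type*} [NormedRing 𝔹] [NormedAlgebra ℝ 𝔹] [CompleteSpace 𝔹]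
    (A : ℝ →ᵇ 𝔹) (s ξ : ℝ) :
    NormedSpace.exp (s • A) ξ = NormedSpace.exp (s • A ξ) := by
  let _ : NormedAlgebra ℚ (ℝ →ᵇ 𝔹) := NormedAlgebra.restrictScalars ℚ ℝ _
  let _ : NormedAlgebra ℚ 𝔹 := NormedAlgebra.restrictScalars ℚ ℝ _
  let e : (ℝ →ᵇ 𝔹) →+* 𝔹 :=
    { toFun := fun f => f ξ
      map_one' := rfl
      map_mul' := fun _ _ => rfl
      map_zero' := rfl
      map_add' := fun _ _ => rfl }
  exact NormedSpace.map_exp e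
    (BoundedContinuousFunction.evalCLM ℝ ξ : (ℝ →ᵇ 𝔹) →L[ℝ] 𝔹).continuous (s • A)

/-- A product rule for W merely continuous in norm: the slope splits into that of Λ applied to W s,
where continuity suffices, and that of W seen through the frozen operator Λ t, where the weak
equation suffices. -/
theorem hasDerivAt_clm_apply_of_frozen {E F : Type*} [NormedAddCommGroup E] [NormedSpace ℝ E]
    [NormedAddCommGroup F] [NormedSpace ℝ F] {Λ : ℝ → E →L[ℝ] F} {Λ' : E →L[ℝ] F}
    {W : ℝ → E} {d : F} {t : ℝ} (hΛ : HasDerivAt Λ Λ' t) (hW : ContinuousAt W t)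
    (hd : HasDerivAt (fun s => Λ t (W s)) d t) :
    HasDerivAt (fun s => Λ s (W s)) (Λ' (W t) + d) t := by
  rw [hasDerivAt_iff_tendsto_slope] at hΛ hd ⊢
  have h1 : Tendsto (fun s => slope Λ t s (W s)) (nhdsWithin t {t}ᶜ) (nhds (Λ' (W t))) :=
    (isBoundedBilinearMap_apply (𝕜 := ℝ)).continuous.continuousAt.tendsto.comp
      (hΛ.prodMk_nhds (hW.tendsto.mono_left nhdsWithin_le_nhds))
  refine (h1.add hd).congr fun s => ?_
  simp only [slope_def_module, smul_apply, sub_apply]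
  rw [← smul_add, sub_add_sub_cancel]

end Pairing

end LaminatedBeam

end

/-! ### The weak equation on the Fourier side -/

noncomputable section

namespace LaminatedBeam

open Complex Filter
open scoped FourierTransform ContDiff

/-- Multiplication of a Schwartz function by the symbol `2πiξ` of the derivative. -/
def mulX (ψ : 𝓢(ℝ, ℂ)) : 𝓢(ℝ, ℂ) :=
  SchwartzMap.smulLeftCLM ℂ (fun ξ : ℝ => (2 * Real.pi * I * ξ : ℂ)) ψ

theorem mulX_apply (ψ : 𝓢(ℝ, ℂ)) (ξ : ℝ) : mulX ψ ξ = (2 * Real.pi * I * ξ) * ψ ξ := by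
  rw [mulX, SchwartzMap.smulLeftCLM_apply_apply (by fun_prop), smul_eq_mul]

theorem iterate_mulX_apply (m : ℕ) (ψ : 𝓢(ℝ, ℂ)) (ξ : ℝ) :
    mulX^[m] ψ ξ = (2 * Real.pi * I * ξ) ^ m * ψ ξ := by
  induction m with
  | zero => simp
  | succ m ih => rw [Function.iterate_succ_apply', mulX_apply, ih]; ring

/-- The sign from integration by parts cancels the one in (𝓕ψ)' = 𝓕(-2πiξψ). Testing against 𝓕ψ
loses nothing, as the Fourier transform is onto Schwartz space. -/
theorem lineDerivOp_apply_fourier (f : 𝓢'(ℝ, State)) (ψ : 𝓢(ℝ, ℂ)) :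
    (∂_{(1 : ℝ)} f) (𝓕 ψ) = f (𝓕 (mulX ψ)) := by
  rw [TemperedDistribution.lineDerivOp_apply_apply, SchwartzMap.lineDerivOp_fourier_eq,
    ← FourierTransform.fourier_neg]
  congr 2
  ext ξ
  have : (fun x : ℝ => x).HasTemperateGrowth := by fun_prop
  simp [mulX_apply, SchwartzMap.smulLeftCLM_apply_apply this]
  ring

theorem iterate_lineDerivOp_apply_fourier (m : ℕ) (f : 𝓢'(ℝ, State)) (ψ : 𝓢(ℝ, ℂ)) :
    ((LineDeriv.lineDerivOp (1 : ℝ))^[m] f) (𝓕 ψ) = f (𝓕 (mulX^[m] ψ)) := by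
  induction m generalizing ψ with
  | zero => rfl
  | succ m ih =>
    rw [Function.iterate_succ_apply', lineDerivOp_apply_fourier, ih, Function.iterate_succ_apply]

theorem lp_apply_fourier (V : L2State) (ψ : 𝓢(ℝ, ℂ)) :
    (V : 𝓢'(ℝ, State)) (𝓕 ψ) = ∫ ξ, ψ ξ • (𝓕 V : L2State) ξ := by
  rw [← TemperedDistribution.fourier_apply, Lp.fourier_toTemperedDistribution_eq,
    Lp.toTemperedDistribution_apply]

theorem integrable_schwartz_smul (ψ : 𝓢(ℝ, ℂ)) (V : L2State) :
    Integrable fun ξ => ψ ξ • V ξ :=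
  memLp_one_iff_integrable.1 ((Lp.memLp V).smul (ψ.memLp 2))

theorem act_eq (A : Matrix (Fin 7) (Fin 7) ℂ) (x : State) :
    act A x = Matrix.toEuclideanCLM (𝕜 := ℂ) (n := Fin 7) A x := rfl

theorem act_integral (A : Matrix (Fin 7) (Fin 7) ℂ) {f : ℝ → State} (hf : Integrable f) :
    act A (∫ ξ, f ξ) = ∫ ξ, act A (f ξ) := by
  simp only [act_eq]
  rw [ContinuousLinearMap.integral_comp_comm _ hf]

theorem integrable_act (A : Matrix (Fin 7) (Fin 7) ℂ) {f : ℝ → State} (hf : Integrable f) :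
    Integrable fun ξ => act A (f ξ) := by
  simp only [act_eq]
  exact ContinuousLinearMap.integrable_comp _ hf

theorem act_smul (A : Matrix (Fin 7) (Fin 7) ℂ) (c : ℂ) (x : State) :
    act A (c • x) = c • act A x := by
  simp only [act_eq, map_smul]

variable {k₁ k₂ k₃ k₄ γ : ℝ} {U₀ : L2State} {U : ℝ → L2State}

theorem symbol_eq_act (ξ : ℝ) (x : State) :
    symbol k₁ k₂ k₃ k₄ γ (2 * Real.pi * ξ) x =
      -(act (matA2 k₄) ((2 * Real.pi * I * ξ) ^ 2 • x)
        + act (matA1 k₁ k₂ k₃ γ 0 1 0) ((2 * Real.pi * I * ξ) • x) + act (matA0 k₁) x) := by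
  simp only [act_eq, symbol, map_sub, map_smul, sub_apply, smul_apply]
  have : (2 * Real.pi * I * ξ) ^ 2 = -((2 * Real.pi * ξ : ℝ) : ℂ) ^ 2 := by
    push_cast; ring_nf; simp
  rw [this]
  push_cast
  rw [neg_smul, show I * (2 * (Real.pi : ℂ) * ξ) = 2 * Real.pi * I * ξ by ring]
  abel

/-- The Fourier transform of a solution, tested against a Schwartz function. -/
theorem IsSolution.hasDerivAt_fourier (hU : IsSolution k₁ k₂ k₃ k₄ γ 0 1 0 U₀ U) {t : ℝ}
    (ht : 0 < t) (ψ : 𝓢(ℝ, ℂ)) :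
    HasDerivAt (fun s => ∫ ξ, ψ ξ • (𝓕 (U s) : L2State) ξ)
      (∫ ξ, ψ ξ • symbol k₁ k₂ k₃ k₄ γ (2 * Real.pi * ξ) ((𝓕 (U t) : L2State) ξ)) t := by
  have h := hU.equation t ht (𝓕 ψ)
  simp only [lineDerivOp_apply_fourier, lp_apply_fourier] at h
  convert h using 1
  set W : L2State := 𝓕 (U t)
  have hi := fun (A : Matrix (Fin 7) (Fin 7) ℂ) (χ : 𝓢(ℝ, ℂ)) =>
    integrable_act A (integrable_schwartz_smul χ W)
  simp only [act_integral _ (integrable_schwartz_smul _ W)]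
  rw [← integral_add (hi _ _) (hi _ _)]
  refine Eq.trans ?_ (congrArg Neg.neg (integral_add ((hi _ _).add (hi _ _)) (hi _ _)))
  rw [← integral_neg]
  congr 1
  ext1 ξ
  rw [symbol_eq_act]
  simp only [mulX_apply]
  simp only [act_smul, smul_neg, smul_add, smul_smul]
  congr 3 <;> ring_nf

/-- The matrix units as bounded operators. -/
def unitOp (i j : Fin 7) : State →L[ℂ] State :=
  (EuclideanSpace.proj j : State →L[ℂ] ℂ).smulRight (EuclideanSpace.single i (1 : ℂ))

/-- Expansion in matrix units reduces operator valued test functions, needed for φ · exp(rA(ξ)), to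
the scalar ones in the definition of a solution. -/
theorem op_apply_eq_sum (A : State →L[ℂ] State) (x : State) :
    A x = ∑ i, ∑ j, unitOp i j (A (EuclideanSpace.single j 1) i • x) := by
  have hx : x = ∑ j, x j • EuclideanSpace.single j (1 : ℂ) := by
    ext i
    simp [Finset.sum_apply, Pi.single_apply]
  conv_lhs => rw [hx]
  ext i
  simp [unitOp, Finset.sum_apply, Pi.single_apply, mul_comm]

theorem integral_op_apply {Φ : ℝ → State →L[ℂ] State} {V : ℝ → State}
    (hV : ∀ i j, Integrable fun ξ => Φ ξ (EuclideanSpace.single j 1) i • V ξ) :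
    ∫ ξ, Φ ξ (V ξ) =
      ∑ i, ∑ j, unitOp i j (∫ ξ, Φ ξ (EuclideanSpace.single j 1) i • V ξ) := by
  have h : ∀ i j, Integrable fun ξ => unitOp i j (Φ ξ (EuclideanSpace.single j 1) i • V ξ) :=
    fun i j => ContinuousLinearMap.integrable_comp _ (hV i j)
  calc ∫ ξ, Φ ξ (V ξ)
      = ∫ ξ, ∑ i, ∑ j, unitOp i j (Φ ξ (EuclideanSpace.single j 1) i • V ξ) :=
        integral_congr_ae (Eventually.of_forall fun ξ => op_apply_eq_sum _ _)
    _ = ∑ i, ∑ j, ∫ ξ, unitOp i j (Φ ξ (EuclideanSpace.single j 1) i • V ξ) := by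
        rw [integral_finsetSum _ fun i _ => integrable_finsetSum _ fun j _ => h i j]
        exact Finset.sum_congr rfl fun i _ => integral_finsetSum _ fun j _ => h i j
    _ = _ := Finset.sum_congr rfl fun i _ => Finset.sum_congr rfl fun j _ =>
        ContinuousLinearMap.integral_comp_comm _ (hV i j)

/-- The Fourier transform of a solution, tested against an operator valued test function. -/
theorem IsSolution.hasDerivAt_fourier_op (hU : IsSolution k₁ k₂ k₃ k₄ γ 0 1 0 U₀ U) {t : ℝ}
    (ht : 0 < t) {Φ : ℝ → State →L[ℂ] State} (hΦ : ContDiff ℝ ∞ Φ) (hΦ' : HasCompactSupport Φ) :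
    HasDerivAt (fun s => ∫ ξ, Φ ξ ((𝓕 (U s) : L2State) ξ))
      (∫ ξ, Φ ξ (symbol k₁ k₂ k₃ k₄ γ (2 * Real.pi * ξ) ((𝓕 (U t) : L2State) ξ))) t := by
  have hc : ∀ i j, ContDiff ℝ ∞ fun ξ => Φ ξ (EuclideanSpace.single j 1) i := fun i j =>
    ((EuclideanSpace.proj i : State →L[ℂ] ℂ).restrictScalars ℝ).contDiff.comp
      (contDiff_clm_apply hΦ _)
  have hs : ∀ i j, HasCompactSupport fun ξ => Φ ξ (EuclideanSpace.single j 1) i := fun i j =>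
    hΦ'.mono fun ξ h => by
      rw [Function.mem_support] at h ⊢
      rintro h0
      exact h (by simp [h0])
  let ψ : Fin 7 → Fin 7 → 𝓢(ℝ, ℂ) := fun i j => (hs i j).toSchwartzMap (hc i j)
  have hM : Continuous fun ξ : ℝ => symbol k₁ k₂ k₃ k₄ γ (2 * Real.pi * ξ) :=
    (contDiff_symbol k₁ k₂ k₃ k₄ γ).continuous.comp (by fun_prop)
  have e1 : ∀ s, ∫ ξ, Φ ξ ((𝓕 (U s) : L2State) ξ) =
      ∑ i, ∑ j, unitOp i j (∫ ξ, ψ i j ξ • (𝓕 (U s) : L2State) ξ) := fun s =>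
    integral_op_apply fun i j => integrable_schwartz_smul (ψ i j) _
  have e2 : ∫ ξ, Φ ξ (symbol k₁ k₂ k₃ k₄ γ (2 * Real.pi * ξ) ((𝓕 (U t) : L2State) ξ)) =
      ∑ i, ∑ j, unitOp i j (∫ ξ, ψ i j ξ •
        symbol k₁ k₂ k₃ k₄ γ (2 * Real.pi * ξ) ((𝓕 (U t) : L2State) ξ)) :=
    integral_op_apply fun i j => integrable_clm_apply
      (A := fun ξ => Φ ξ (EuclideanSpace.single j 1) i • symbol k₁ k₂ k₃ k₄ γ (2 * Real.pi * ξ))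
      ((hc i j).continuous.smul hM) (hs i j).smul_right (locallyIntegrable_lp _)
  rw [e2]
  simp only [e1]
  refine HasDerivAt.fun_sum fun i _ => HasDerivAt.fun_sum fun j _ => ?_
  exact ((unitOp i j).restrictScalars ℝ).hasFDerivAt.comp_hasDerivAt t
    (hU.hasDerivAt_fourier ht (ψ i j))

end LaminatedBeam

end

/-! ### Identification of the solution with the matrix exponential -/

noncomputable section

namespace LaminatedBeam

open Complex Filter
open scoped FourierTransform ContDiff BoundedContinuousFunction

theorem hasDerivAt_exp_sub_smul {𝔸 G : Type*} [NormedRing 𝔸] [NormedAlgebra ℝ 𝔸]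
    [CompleteSpace 𝔸] [NormedAddCommGroup G] [NormedSpace ℝ G] (L : 𝔸 →L[ℝ] G) (A : 𝔸) (T s : ℝ) :
    HasDerivAt (fun s => L (NormedSpace.exp ((T - s) • A)))
      (-L (NormedSpace.exp ((T - s) • A) * A)) s := by
  have h1 := (hasDerivAt_exp_smul_const (𝕂 := ℝ) A (T - s)).scomp s
    ((hasDerivAt_id s).const_sub T)
  have h2 := L.hasFDerivAt.comp_hasDerivAt s h1
  rw [neg_one_smul, map_neg] at h2
  exact h2

theorem locallyIntegrable_clm_apply {H : Type*} [NormedAddCommGroup H] [InnerProductSpace ℂ H]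
    {A : ℝ → H →L[ℂ] H} (hA : Continuous A) {V : ℝ → H} (hV : LocallyIntegrable V) :
    LocallyIntegrable fun ξ => A ξ (V ξ) := by
  rw [locallyIntegrable_iff]
  intro s hs
  obtain ⟨C, hC⟩ := hs.exists_bound_of_continuousOn hA.continuousOn
  have h1 : IntegrableOn (fun ξ => C * ‖V ξ‖) s :=
    ((hV.integrableOn_isCompact hs).norm).const_mul C
  refine h1.mono' ((ContinuousLinearMap.id ℂ (H →L[ℂ] H)).aestronglyMeasurable_comp₂
    hA.aestronglyMeasurable hV.aestronglyMeasurable).restrict ?_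
  filter_upwards [ae_restrict_mem hs.measurableSet] with ξ hξ
  exact ((A ξ).le_opNorm _).trans (by gcongr; exact hC ξ hξ)

/-- A continuous operator valued function agrees on a compact set with a bounded one. -/
theorem exists_bcf_eq_on {H : Type*} [NormedAddCommGroup H] [InnerProductSpace ℂ H]
    {A : ℝ → H →L[ℂ] H} (hA : Continuous A) {s : Set ℝ} (hs : IsCompact s) :
    ∃ B : ℝ →ᵇ (H →L[ℂ] H), ∀ ξ ∈ s, B ξ = A ξ := by
  obtain ⟨R, hR⟩ := hs.isBounded.subset_closedBall (0 : ℝ)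
  let χ : ContDiffBump (0 : ℝ) := ⟨max R 1, max R 1 + 1, by positivity, by linarith⟩
  have hc : Continuous fun ξ => χ ξ • A ξ := χ.continuous.smul hA
  obtain ⟨C, hC⟩ := hc.bounded_above_of_compact_support χ.hasCompactSupport.smul_right
  refine ⟨BoundedContinuousFunction.ofNormedAddCommGroup _ hc C hC, fun ξ hξ => ?_⟩
  have : χ ξ = 1 := χ.one_of_mem_closedBall
    (Metric.closedBall_subset_closedBall (le_max_left _ _) (hR hξ))
  simp [this]

theorem contDiff_exp_smul {H : Type*} [NormedAddCommGroup H] [InnerProductSpace ℂ H]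
    [CompleteSpace H] {A : ℝ → H →L[ℂ] H} (hA : ContDiff ℝ ∞ A) (s : ℝ) :
    ContDiff ℝ ∞ fun ξ : ℝ => NormedSpace.exp (s • A ξ) :=
  contDiff_exp.comp (hA.const_smul s)

theorem contDiff_smul_exp_smul {H : Type*} [NormedAddCommGroup H] [InnerProductSpace ℂ H]
    [CompleteSpace H] {A : ℝ → H →L[ℂ] H} (hA : ContDiff ℝ ∞ A) {φ : ℝ → ℝ} (hφ : ContDiff ℝ ∞ φ)
    (s : ℝ) : ContDiff ℝ ∞ fun ξ : ℝ => φ ξ • NormedSpace.exp (s • A ξ) :=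
  hφ.smul (contDiff_exp_smul hA s)

theorem hasCompactSupport_smul {H : Type*} [NormedAddCommGroup H] [InnerProductSpace ℂ H]
    (A : ℝ → H →L[ℂ] H) {φ : ℝ → ℝ} (hφ : HasCompactSupport φ) :
    HasCompactSupport fun ξ : ℝ => φ ξ • A ξ :=
  hφ.smul_right

section Evolution

variable {H : Type*} [NormedAddCommGroup H] [InnerProductSpace ℂ H] [CompleteSpace H]

/-- Backward evolution: s ↦ J(exp((T - s)B)) W(s) has zero derivative on (0, ∞), so its value at s =
T equals its limit as s → 0⁺, where the continuity of W up to 0 enters. -/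
theorem eq_exp_apply_of_hasDerivAt {𝔸 E F : Type*} [NormedRing 𝔸] [NormedAlgebra ℝ 𝔸]
    [CompleteSpace 𝔸] [NormedAddCommGroup E] [NormedSpace ℝ E] [NormedAddCommGroup F]
    [NormedSpace ℝ F] (J : 𝔸 →L[ℝ] E →L[ℝ] F) (B : 𝔸) {W : ℝ → E}
    (hWc : ContinuousOn W (Set.Ici 0)) {T : ℝ} (hT : 0 < T)
    (hW : ∀ r s : ℝ, 0 < s → HasDerivAt (fun t => J (NormedSpace.exp (r • B)) (W t))
      (J (NormedSpace.exp (r • B) * B) (W s)) s) :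
    J 1 (W T) = J (NormedSpace.exp (T • B)) (W 0) := by
  have hd : ∀ s, 0 < s → HasDerivAt (fun s => J (NormedSpace.exp ((T - s) • B)) (W s)) 0 s := by
    intro s hs
    have h4 := hasDerivAt_clm_apply_of_frozen (hasDerivAt_exp_sub_smul J B T s)
      (hWc.continuousAt (Ici_mem_nhds hs)) (hW (T - s) s hs)
    rwa [neg_apply, neg_add_cancel] at h4
  have hconst : ∀ s, 0 < s →
      J (NormedSpace.exp ((T - s) • B)) (W s) = J (NormedSpace.exp ((T - T) • B)) (W T) :=
    fun s hs => isOpen_Ioi.is_const_of_deriv_eq_zero isPreconnected_Ioi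
      (fun r hr => (hd r hr).differentiableAt.differentiableWithinAt)
      (fun r hr => (hd r hr).deriv) hs hT
  have hlim : Tendsto (fun s => J (NormedSpace.exp ((T - s) • B)) (W s)) (nhdsWithin 0 (Set.Ioi 0))
      (nhds (J (NormedSpace.exp ((T - 0) • B)) (W 0))) := by
    have h1 : Tendsto W (nhdsWithin 0 (Set.Ioi 0)) (nhds (W 0)) :=
      (hWc 0 Set.self_mem_Ici).mono_left (nhdsWithin_mono _ Set.Ioi_subset_Ici_self)
    have h2 := (hasDerivAt_exp_sub_smul J B T 0).continuousAt.tendsto.mono_left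
      (nhdsWithin_le_nhds (s := Set.Ioi 0))
    exact (isBoundedBilinearMap_apply (𝕜 := ℝ)).continuous.continuousAt.tendsto.comp
      (h2.prodMk_nhds h1)
  have heq := tendsto_nhds_unique hlim (tendsto_const_nhds.congr' (by
    filter_upwards [self_mem_nhdsWithin] with s hs
    exact (hconst s hs).symm))
  rw [sub_zero, sub_self, zero_smul] at heq
  let _ : NormedAlgebra ℚ 𝔸 := NormedAlgebra.restrictScalars ℚ ℝ _
  rw [heq, NormedSpace.exp_zero]

/-- A function solving `W' = A W` in the weak sense is given by the exponential, weakly. -/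
theorem integral_smul_eq_of_hasDerivAt {A : ℝ → H →L[ℂ] H} (hA : Continuous A)
    {W : ℝ → Lp H 2 (volume : Measure ℝ)} (hWc : ContinuousOn W (Set.Ici 0)) {T : ℝ} (hT : 0 < T)
    {φ : ℝ → ℝ} (hφ : Continuous φ) (hφ' : HasCompactSupport φ)
    (hW : ∀ r s : ℝ, 0 < s → HasDerivAt
      (fun t => ∫ ξ, (φ ξ • NormedSpace.exp (r • A ξ)) (W t ξ))
      (∫ ξ, (φ ξ • NormedSpace.exp (r • A ξ)) (A ξ (W s ξ))) s) :
    ∫ ξ, φ ξ • W T ξ = ∫ ξ, φ ξ • NormedSpace.exp (T • A ξ) (W 0 ξ) := by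
  -- The symbol is unbounded in ξ. Only its values on the support of φ matter, and a bounded
  -- replacement makes its exponential norm differentiable in the Banach algebra of bounded
  -- continuous operator functions.
  obtain ⟨B, hB⟩ := exists_bcf_eq_on hA hφ'.isCompact
  have hB' : ∀ ξ, φ ξ ≠ 0 → B ξ = A ξ := fun ξ h => hB ξ (subset_tsupport φ h)
  have hΛ : ∀ (r : ℝ) (V : Lp H 2 (volume : Measure ℝ)),
      testPairing hφ hφ' (NormedSpace.exp (r • B)) V =
        ∫ ξ, (φ ξ • NormedSpace.exp (r • A ξ)) (V ξ) := by
    intro r V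
    rw [testPairing_apply]
    refine integral_congr_ae (Eventually.of_forall fun ξ => ?_)
    simp only [smul_apply]
    by_cases h : φ ξ = 0
    · rw [h, zero_smul, zero_smul]
    · rw [exp_bcf_apply, hB' ξ h]
  have hΛ' : ∀ (r : ℝ) (V : Lp H 2 (volume : Measure ℝ)),
      testPairing hφ hφ' (NormedSpace.exp (r • B) * B) V =
        ∫ ξ, (φ ξ • NormedSpace.exp (r • A ξ)) (A ξ (V ξ)) := by
    intro r V
    rw [testPairing_apply]
    refine integral_congr_ae (Eventually.of_forall fun ξ => ?_)
    simp only [smul_apply]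
    by_cases h : φ ξ = 0
    · rw [h, zero_smul, zero_smul]
    · rw [BoundedContinuousFunction.mul_apply, exp_bcf_apply, hB' ξ h]
      rfl
  have heq := eq_exp_apply_of_hasDerivAt (testPairing hφ hφ') B hWc hT fun r s hs => by
    simp only [hΛ, hΛ']
    exact hW r s hs
  have h1 := hΛ T (W 0)
  rw [← heq, testPairing_apply] at h1
  simpa using h1

end Evolution

variable {k₁ k₂ k₃ k₄ γ : ℝ} {U₀ : L2State} {U : ℝ → L2State}

theorem IsSolution.continuousOn_fourier (hU : IsSolution k₁ k₂ k₃ k₄ γ 0 1 0 U₀ U) :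
    ContinuousOn (fun s => (𝓕 (U s) : L2State)) (Set.Ici 0) :=
  (Lp.fourierTransformₗᵢ ℝ State).continuous.comp_continuousOn hU.continuousOn

theorem contDiff_symbol_two_pi (k₁ k₂ k₃ k₄ γ : ℝ) :
    ContDiff ℝ ∞ fun ξ : ℝ => symbol k₁ k₂ k₃ k₄ γ (2 * Real.pi * ξ) :=
  (contDiff_symbol k₁ k₂ k₃ k₄ γ).comp (contDiff_const.mul contDiff_id)

theorem IsSolution.integral_smul_fourier (hU : IsSolution k₁ k₂ k₃ k₄ γ 0 1 0 U₀ U) {T : ℝ}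
    (hT : 0 < T) {φ : ℝ → ℝ} (hφ : ContDiff ℝ ∞ φ) (hφ' : HasCompactSupport φ) :
    ∫ ξ, φ ξ • (𝓕 (U T) : L2State) ξ =
      ∫ ξ, φ ξ • NormedSpace.exp (T • symbol k₁ k₂ k₃ k₄ γ (2 * Real.pi * ξ))
        ((𝓕 U₀ : L2State) ξ) := by
  have hM := contDiff_symbol_two_pi k₁ k₂ k₃ k₄ γ
  have hd : ∀ r s : ℝ, 0 < s → HasDerivAt
      (fun t => ∫ ξ, (φ ξ • NormedSpace.exp (r • symbol k₁ k₂ k₃ k₄ γ (2 * Real.pi * ξ)))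
        ((𝓕 (U t) : L2State) ξ))
      (∫ ξ, (φ ξ • NormedSpace.exp (r • symbol k₁ k₂ k₃ k₄ γ (2 * Real.pi * ξ)))
        (symbol k₁ k₂ k₃ k₄ γ (2 * Real.pi * ξ) ((𝓕 (U s) : L2State) ξ))) s := by
    intro r s hs
    exact hU.hasDerivAt_fourier_op hs (contDiff_smul_exp_smul hM hφ r)
      (hasCompactSupport_smul _ hφ')
  have h := integral_smul_eq_of_hasDerivAt hM.continuous hU.continuousOn_fourier hT
    hφ.continuous hφ' hd
  rwa [hU.initial] at h

/-- The Fourier transform of the solution is given by the evolution at each frequency. -/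
theorem IsSolution.fourier_ae_eq (hU : IsSolution k₁ k₂ k₃ k₄ γ 0 1 0 U₀ U) {T : ℝ}
    (hT : 0 ≤ T) : ∀ᵐ ξ : ℝ, (𝓕 (U T) : L2State) ξ =
      NormedSpace.exp (T • symbol k₁ k₂ k₃ k₄ γ (2 * Real.pi * ξ)) ((𝓕 U₀ : L2State) ξ) := by
  rcases hT.eq_or_lt with rfl | hT
  · simp [exp_zero_smul_apply, hU.initial]
  · exact ae_eq_of_integral_contDiff_smul_eq (locallyIntegrable_lp _)
      (locallyIntegrable_clm_apply 
        (contDiff_exp_smul (contDiff_symbol_two_pi k₁ k₂ k₃ k₄ γ) T).continuous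
        (locallyIntegrable_lp _))
      fun φ hφ hφ' => hU.integral_smul_fourier hT hφ hφ'

end LaminatedBeam

end

/-! ### L¹ data, Sobolev regularity and weak derivatives in Fourier variables -/

noncomputable section

namespace LaminatedBeam

open Complex Filter
open scoped FourierTransform ContDiff

theorem ae_eq_of_integral_schwartz_smul_eq {V W : ℝ → State} (hV : LocallyIntegrable V)
    (hW : LocallyIntegrable W) (h : ∀ ψ : 𝓢(ℝ, ℂ), ∫ ξ, ψ ξ • V ξ = ∫ ξ, ψ ξ • W ξ) :
    ∀ᵐ ξ, V ξ = W ξ := by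
  refine ae_eq_of_integral_contDiff_smul_eq hV hW fun φ hφ hφ' => ?_
  have hc : ContDiff ℝ ∞ fun ξ => (φ ξ : ℂ) := ofRealCLM.contDiff.comp hφ
  have hs : HasCompactSupport fun ξ => (φ ξ : ℂ) := hφ'.comp_left ofReal_zero
  simpa using h (hs.toSchwartzMap hc)

/-- On `L¹ ∩ L²` the Fourier transform of `L²` is the Fourier integral. -/
theorem fourier_lp_ae_eq (V : L2State) (hV : Integrable (fun x : ℝ => V x) volume) :
    ∀ᵐ ξ, (𝓕 V : L2State) ξ = 𝓕 (fun x : ℝ => V x) ξ := by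
  have hc : Continuous (𝓕 (fun x : ℝ => V x)) :=
    VectorFourier.fourierIntegral_continuous Real.continuous_fourierChar
      (by exact continuous_inner) hV
  refine ae_eq_of_integral_schwartz_smul_eq (locallyIntegrable_lp _) hc.locallyIntegrable
    fun ψ => ?_
  rw [← lp_apply_fourier, Lp.toTemperedDistribution_apply]
  have h := VectorFourier.integral_fourierIntegral_smul_eq_flip (L := innerₗ ℝ) (μ := volume)
    (ν := volume) (e := Real.fourierChar) (f := ψ) (g := fun x : ℝ => V x)
    Real.continuous_fourierChar continuous_inner ψ.integrable hV
  rw [flip_innerₗ] at h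
  exact h

theorem norm_fourier_lp_le (V : L2State) (hV : Integrable (fun x : ℝ => V x) volume) :
    ∀ᵐ ξ, ‖(𝓕 V : L2State) ξ‖ ≤ ∫ x : ℝ, ‖V x‖ := by
  filter_upwards [fourier_lp_ae_eq V hV] with ξ h
  rw [h]
  exact VectorFourier.norm_fourierIntegral_le_integral_norm _ _ _ _ _

theorem MemH.exists_hasL2Deriv {N m : ℕ} {f : L2State} (hf : MemH N f) (hm : m ≤ N) :
    ∃ g, HasL2Deriv m f g := by
  have h : ∀ n : ℕ, TemperedDistribution.MemSobolev ((N : ℝ) - n) 2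
      ((LineDeriv.lineDerivOp (1 : ℝ))^[n] (f : 𝓢'(ℝ, State))) := by
    intro n
    induction n with
    | zero => simpa [MemH] using hf
    | succ n ih =>
      rw [Function.iterate_succ_apply']
      have h := ih.lineDerivOp (m := (1 : ℝ))
      rw [sub_sub, ← Nat.cast_succ] at h
      exact h
  have h0 : (0 : ℝ) ≤ (N : ℝ) - m := sub_nonneg.2 (by exact_mod_cast hm)
  exact TemperedDistribution.memSobolev_zero_iff.1 ((h m).mono h0)

theorem locallyIntegrable_pow_smul (m : ℕ) (V : L2State) :
    LocallyIntegrable fun ξ : ℝ => (2 * Real.pi * I * ξ : ℂ) ^ m • V ξ := by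
  have hc : Continuous fun ξ : ℝ => (2 * Real.pi * I * ξ : ℂ) ^ m := by fun_prop
  exact locallyIntegrableOn_univ.1 <|
    ((locallyIntegrable_lp V).locallyIntegrableOn Set.univ).continuousOn_smul isOpen_univ.isLocallyClosed hc.continuousOn

theorem hasL2Deriv_iff (m : ℕ) (f g : L2State) :
    HasL2Deriv m f g ↔
      ∀ᵐ ξ : ℝ, (𝓕 g : L2State) ξ = (2 * Real.pi * I * ξ : ℂ) ^ m • (𝓕 f : L2State) ξ := by
  have e : ∀ ψ : 𝓢(ℝ, ℂ), (f : 𝓢'(ℝ, State)) (𝓕 (mulX^[m] ψ)) =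
      ∫ ξ : ℝ, ψ ξ • (2 * Real.pi * I * ξ : ℂ) ^ m • (𝓕 f : L2State) ξ := fun ψ => by
    rw [lp_apply_fourier]
    simp only [iterate_mulX_apply, smul_smul, mul_comm]
  constructor
  · intro h
    refine ae_eq_of_integral_schwartz_smul_eq (locallyIntegrable_lp _)
      (locallyIntegrable_pow_smul m _) fun ψ => ?_
    rw [← lp_apply_fourier, ← e, ← iterate_lineDerivOp_apply_fourier]
    exact congrArg (fun d : 𝓢'(ℝ, State) => d (𝓕 ψ)) h.symm
  · intro h
    rw [HasL2Deriv]
    ext1 χ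
    -- Every Schwartz function is 𝓕 of its inverse transform, so pairings with transforms determine
    -- the distribution.
    rw [← FourierTransform.fourier_fourierInv_eq (F := 𝓢(ℝ, ℂ)) χ,
      iterate_lineDerivOp_apply_fourier, e,
      lp_apply_fourier]
    refine integral_congr_ae ?_
    filter_upwards [h] with ξ hξ
    rw [hξ]

theorem norm_symbol_deriv (m : ℕ) (ξ : ℝ) :
    ‖(2 * Real.pi * I * ξ : ℂ) ^ m‖ = |2 * Real.pi * ξ| ^ m := by
  rw [norm_pow]
  simp [abs_mul]

/-- A function whose Fourier transform is dominated by that of an `m` times weakly differentiable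
function is `m` times weakly differentiable. -/
theorem exists_hasL2Deriv_of_norm_fourier_le {m : ℕ} {f g h : L2State} {K : ℝ}
    (hg : HasL2Deriv m f g)
    (hK : ∀ᵐ ξ : ℝ, ‖(𝓕 h : L2State) ξ‖ ≤ K * ‖(𝓕 f : L2State) ξ‖) :
    ∃ d, HasL2Deriv m h d := by
  have hmem : MemLp (fun ξ : ℝ => (2 * Real.pi * I * ξ : ℂ) ^ m • (𝓕 h : L2State) ξ) 2 := by
    refine (Lp.memLp (𝓕 g : L2State)).of_le_mul (c := K)
      (locallyIntegrable_pow_smul m _).aestronglyMeasurable ?_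
    filter_upwards [hK, (hasL2Deriv_iff m f g).1 hg] with ξ h1 h2
    rw [h2, norm_smul, norm_smul, mul_left_comm]
    gcongr
  refine ⟨𝓕⁻ hmem.toLp, (hasL2Deriv_iff m _ _).2 ?_⟩
  rw [FourierTransform.fourier_fourierInv_eq]
  exact hmem.coeFn_toLp

theorem HasL2Deriv.norm_sq {m : ℕ} {f g : L2State} (h : HasL2Deriv m f g) :
    ‖g‖ ^ 2 = ∫ ξ : ℝ, (|2 * Real.pi * ξ| ^ m * ‖(𝓕 f : L2State) ξ‖) ^ 2 := by
  rw [← Lp.norm_fourier_eq, norm_sq_eq_integral]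
  refine integral_congr_ae ?_
  filter_upwards [(hasL2Deriv_iff m f g).1 h] with ξ hξ
  rw [hξ, norm_smul, norm_symbol_deriv]

theorem HasL2Deriv.integrable {m : ℕ} {f g : L2State} (h : HasL2Deriv m f g) :
    Integrable fun ξ : ℝ => (|2 * Real.pi * ξ| ^ m * ‖(𝓕 f : L2State) ξ‖) ^ 2 := by
  refine ((Lp.memLp (𝓕 g : L2State)).integrable_norm_pow (by norm_num)).congr ?_
  filter_upwards [(hasL2Deriv_iff m f g).1 h] with ξ hξ
  rw [hξ, norm_smul, norm_symbol_deriv]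

end LaminatedBeam

end

/-! ### Frequency integrals and the final estimate -/

noncomputable section

namespace LaminatedBeam

open Complex Filter
open scoped FourierTransform

/-- The inequality s ≤ exp s at s = cx/a, raised to the power a. -/
theorem rpow_mul_exp_neg_le {a c x : ℝ} (ha : 0 < a) (hc : 0 < c) (hx : 0 ≤ x) :
    x ^ a * Real.exp (-(c * x)) ≤ (a / c) ^ a := by
  have h1 : c * x / a ≤ Real.exp (c * x / a) := (by linarith : c * x / a ≤ c * x / a + 1).trans
    (Real.add_one_le_exp _)
  have h2 : (c * x / a) ^ a ≤ Real.exp (c * x) := by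
    refine (Real.rpow_le_rpow (by positivity) h1 ha.le).trans (le_of_eq ?_)
    rw [← Real.exp_mul, div_mul_cancel₀ _ ha.ne']
  have h3 : x ^ a = (a / c) ^ a * (c * x / a) ^ a := by
    rw [← Real.mul_rpow (by positivity) (by positivity)]
    congr 1
    field_simp
  rw [Real.exp_neg, ← div_eq_mul_inv, div_le_iff₀ (Real.exp_pos _), h3]
  gcongr

theorem integrable_pow_mul_exp_neg_pow_four (j : ℕ) {c : ℝ} (hc : 0 < c) :
    Integrable fun x : ℝ => (|x| ^ j) ^ 2 * Real.exp (-(c * x ^ 4)) := by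
  -- A Gaussian majorant, from x⁴ ≥ x² - 1.
  have h : Integrable fun x : ℝ => Real.exp c * (x ^ ((2 * j : ℕ) : ℝ) * Real.exp (-c * x ^ 2)) :=
    (integrable_rpow_mul_exp_neg_mul_sq hc (by
      have : (0 : ℝ) ≤ ((2 * j : ℕ) : ℝ) := Nat.cast_nonneg _
      linarith)).const_mul _
  refine h.mono' (by fun_prop) (Eventually.of_forall fun x => ?_)
  rw [Real.norm_of_nonneg (by positivity), Real.rpow_natCast, ← pow_mul, mul_comm j, pow_mul,
    sq_abs, ← pow_mul, mul_left_comm, ← Real.exp_add]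
  gcongr
  · rw [pow_mul]; positivity
  · nlinarith [mul_nonneg hc.le (sq_nonneg (x ^ 2 - 1)), mul_nonneg hc.le (sq_nonneg x)]

theorem exists_integral_low_frequency_le (j : ℕ) {c : ℝ} (hc : 0 < c) :
    ∃ C : ℝ, 0 ≤ C ∧ ∀ s : ℝ, 0 < s →
      Integrable (fun ξ : ℝ =>
        (|2 * Real.pi * ξ| ^ j) ^ 2 * Real.exp (-(c * s * (2 * Real.pi * ξ) ^ 4))) ∧
      ∫ ξ : ℝ, (|2 * Real.pi * ξ| ^ j) ^ 2 * Real.exp (-(c * s * (2 * Real.pi * ξ) ^ 4)) ≤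
        (C * s ^ (-(1 / 8 : ℝ) - (j : ℝ) / 4)) ^ 2 := by
  set g : ℝ → ℝ := fun x => (|x| ^ j) ^ 2 * Real.exp (-(c * x ^ 4)) with hg
  have hgi : Integrable g := integrable_pow_mul_exp_neg_pow_four j hc
  have hg0 : 0 ≤ ∫ x, g x := integral_nonneg fun x => by positivity
  refine ⟨√(∫ x, g x), Real.sqrt_nonneg _, fun s hs => ?_⟩
  -- The substitution that absorbs s into ω⁴: it produces r^(-2j-1), whose square root is
  -- s^(-1/8-j/4).
  set r : ℝ := s ^ (1 / 4 : ℝ) with hr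
  have hr0 : 0 < r := by positivity
  have hr4 : r ^ 4 = s := by
    rw [hr, ← Real.rpow_natCast, ← Real.rpow_mul hs.le]; norm_num
  have e : (fun ξ : ℝ => (|2 * Real.pi * ξ| ^ j) ^ 2 * Real.exp (-(c * s * (2 * Real.pi * ξ) ^ 4)))
      = fun ξ => (r ^ (2 * j))⁻¹ * g ((r * (2 * Real.pi)) * ξ) := by
    ext ξ
    rw [hg]
    simp only
    rw [mul_assoc r, abs_mul r, abs_of_pos hr0, mul_pow r, mul_pow r, ← hr4, mul_pow (r ^ j),
      ← pow_mul r, mul_comm j 2, mul_assoc c]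
    field_simp
  have hne : r * (2 * Real.pi) ≠ 0 := by positivity
  rw [e]
  refine ⟨(hgi.comp_mul_left' hne).const_mul _, ?_⟩
  rw [integral_const_mul, Measure.integral_comp_mul_left, smul_eq_mul, mul_pow,
    Real.sq_sqrt hg0, abs_of_pos (by positivity)]
  have h1 : (s ^ (-(1 / 8 : ℝ) - (j : ℝ) / 4)) ^ 2 = (r ^ (2 * j))⁻¹ * r⁻¹ := by
    rw [hr, ← Real.rpow_natCast, ← Real.rpow_natCast, ← Real.rpow_mul hs.le, ← Real.rpow_mul hs.le,
      ← Real.rpow_neg hs.le, ← Real.rpow_neg hs.le, ← Real.rpow_add hs]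
    congr 1
    push_cast
    ring
  rw [h1, mul_inv]
  have h2 : (2 * Real.pi)⁻¹ ≤ 1 := inv_le_one_of_one_le₀ (by linarith [Real.pi_gt_three])
  calc (r ^ (2 * j))⁻¹ * (r⁻¹ * (2 * Real.pi)⁻¹ * ∫ x, g x)
      = ((∫ x, g x) * ((r ^ (2 * j))⁻¹ * r⁻¹)) * (2 * Real.pi)⁻¹ := by ring
    _ ≤ ((∫ x, g x) * ((r ^ (2 * j))⁻¹ * r⁻¹)) * 1 := by gcongr
    _ = _ := mul_one _

/-- Frequencies above one: the decay rate against the regularity of the data. -/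
theorem exp_neg_rate_four_le {ℓ : ℕ} (hℓ : 1 ≤ ℓ) {c : ℝ} (hc : 0 < c) {t : ℝ} (ht : 0 ≤ t)
    {ω : ℝ} (hω : 1 < |ω|) :
    Real.exp (-(c * rate 4 ω * t)) ≤
      Real.exp c * ((ℓ / 4 : ℝ) / c) ^ (ℓ / 4 : ℝ) * (1 + t) ^ (-(ℓ : ℝ) / 4) * |ω| ^ ℓ := by
  have hω0 : 0 < |ω| := one_pos.trans hω
  have hr : rate 4 ω = (|ω| ^ 4)⁻¹ := if_neg hω.not_ge
  set r := (|ω| ^ 4)⁻¹ with hr'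
  have hr0 : 0 < r := by positivity
  have hr1 : r ≤ 1 := inv_le_one_of_one_le₀ (one_le_pow₀ hω.le)
  have ha : (0 : ℝ) < ℓ / 4 := by positivity
  -- With exponent ℓ/4 the factor r^(ℓ/4) is exactly |ω|^(-ℓ). Passing from t to 1 + t costs exp c,
  -- since r ≤ 1.
  have h1 := rpow_mul_exp_neg_le ha hc (by positivity : 0 ≤ r * (1 + t))
  rw [Real.mul_rpow hr0.le (by positivity)] at h1
  have h2 : r ^ (ℓ / 4 : ℝ) = (|ω| ^ ℓ)⁻¹ := by
    rw [hr', ← Real.rpow_natCast, ← Real.rpow_neg hω0.le, ← Real.rpow_mul hω0.le,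
      ← Real.rpow_natCast, ← Real.rpow_neg hω0.le]
    congr 1
    push_cast
    ring
  have h3 : Real.exp (-(c * r * t)) ≤ Real.exp c * Real.exp (-(c * (r * (1 + t)))) := by
    rw [← Real.exp_add]
    gcongr
    nlinarith
  have h4 : (1 + t) ^ (-(ℓ : ℝ) / 4) = ((1 + t) ^ (ℓ / 4 : ℝ))⁻¹ := by
    rw [← Real.rpow_neg (by positivity)]; congr 1; ring
  rw [hr, h4]
  refine h3.trans ?_
  rw [h2] at h1
  have h5 : 0 < (1 + t) ^ (ℓ / 4 : ℝ) := by positivity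
  have h6 : Real.exp (-(c * (r * (1 + t)))) ≤
      ((ℓ / 4 : ℝ) / c) ^ (ℓ / 4 : ℝ) * ((1 + t) ^ (ℓ / 4 : ℝ))⁻¹ * |ω| ^ ℓ := by
    have : Real.exp (-(c * (r * (1 + t)))) = ((|ω| ^ ℓ)⁻¹ * (1 + t) ^ (ℓ / 4 : ℝ) *
        Real.exp (-(c * (r * (1 + t))))) * ((1 + t) ^ (ℓ / 4 : ℝ))⁻¹ * |ω| ^ ℓ := by
      field_simp
    rw [this]
    gcongr
  calc _ ≤ Real.exp c *
        (((ℓ / 4 : ℝ) / c) ^ (ℓ / 4 : ℝ) * ((1 + t) ^ (ℓ / 4 : ℝ))⁻¹ * |ω| ^ ℓ) := by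
        gcongr
    _ = _ := by ring

/-- The pointwise bound on the Fourier side. -/
theorem sq_norm_fourier_le {K c β t M ω a b : ℝ} {j ℓ q : ℕ} (hc : 0 < c) (hK : 0 ≤ K)
    (ha : 0 ≤ a) (hb : 0 ≤ b) (hbM : b ≤ M)
    (hβ : 1 < |ω| → Real.exp (-(c * rate q ω * t)) ≤ β * |ω| ^ ℓ)
    (hab : a ≤ K * Real.exp (-(c * rate q ω * t)) * b) :
    (|ω| ^ j * a) ^ 2 ≤ (K * Real.exp c * M) ^ 2 *
        ((|ω| ^ j) ^ 2 * Real.exp (-(2 * c * (1 + t) * ω ^ 4)))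
      + (K * β) ^ 2 * (|ω| ^ (j + ℓ) * b) ^ 2 := by
  have hM : 0 ≤ M := hb.trans hbM
  rcases le_or_gt |ω| 1 with h | h
  · have hr : rate q ω = ω ^ 4 := if_pos h
    have h4 : ω ^ 4 ≤ 1 := by
      rw [← Even.pow_abs (by decide : Even 4)]
      exact pow_le_one₀ (abs_nonneg _) h
    have h1 : a ≤ K * (Real.exp c * Real.exp (-(c * (1 + t) * ω ^ 4))) * M := by
      refine hab.trans ?_
      rw [hr, ← Real.exp_add]
      gcongr
      nlinarith
    calc (|ω| ^ j * a) ^ 2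
        ≤ (|ω| ^ j * (K * (Real.exp c * Real.exp (-(c * (1 + t) * ω ^ 4))) * M)) ^ 2 := by gcongr
      _ = (K * Real.exp c * M) ^ 2 * ((|ω| ^ j) ^ 2 * Real.exp (-(2 * c * (1 + t) * ω ^ 4))) := by
        rw [show -(2 * c * (1 + t) * ω ^ 4) = (2 : ℕ) * -(c * (1 + t) * ω ^ 4) by push_cast; ring,
          Real.exp_nat_mul]
        ring
      _ ≤ _ := le_add_of_nonneg_right (by positivity)
  · have h1 : a ≤ K * (β * |ω| ^ ℓ) * b := hab.trans (by gcongr; exact hβ h)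
    calc (|ω| ^ j * a) ^ 2 ≤ (|ω| ^ j * (K * (β * |ω| ^ ℓ) * b)) ^ 2 := by gcongr
      _ = (K * β) ^ 2 * (|ω| ^ (j + ℓ) * b) ^ 2 := by rw [pow_add]; ring
      _ ≤ _ := le_add_of_nonneg_left (by positivity)

/-- Both cases of the theorem at once: β stands for the decay factor of the high frequencies,
measured against |ω|^ℓ, and is the only quantity through which they differ. -/
theorem exists_norm_deriv_le {k₁ k₂ k₃ k₄ γ : ℝ} (hk₁ : 0 < k₁) (hk₂ : 0 < k₂) (hk₃ : 0 < k₃)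
    (hk₄ : 0 < k₄) (hγ : 0 < γ) {q : ℕ} (hq : q = 0 ∧ k₁ = k₂ ∧ k₂ = k₃ ∨ q = 4) (j : ℕ) :
    ∃ C c : ℝ, 0 < C ∧ 0 < c ∧ ∀ {ℓ : ℕ} {U₀ D₀ Dⱼ : L2State} {U : ℝ → L2State} {t β : ℝ},
      IsSolution k₁ k₂ k₃ k₄ γ 0 1 0 U₀ U → Integrable (fun x : ℝ => U₀ x) volume →
      HasL2Deriv (j + ℓ) U₀ D₀ → HasL2Deriv j U₀ Dⱼ → 0 ≤ t → 0 ≤ β →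
      (∀ ω : ℝ, 1 < |ω| → Real.exp (-(c * rate q ω * t)) ≤ β * |ω| ^ ℓ) →
      ∃ D : L2State, HasL2Deriv j (U t) D ∧
        ‖D‖ ≤ C * (1 + t) ^ (-(1 / 8 : ℝ) - (j : ℝ) / 4) * (∫ x : ℝ, ‖U₀ x‖) + C * β * ‖D₀‖ := by
  obtain ⟨K, c, hK, hc, hexp⟩ := exists_norm_exp_symbol_le_rate hk₁ hk₂ hk₃ hk₄ hγ hq
  obtain ⟨C, hC, hlow⟩ := exists_integral_low_frequency_le j (by positivity : 0 < 2 * c)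
  have hK0 : 0 ≤ K := zero_le_one.trans hK
  refine ⟨K * Real.exp c * C + K, c, by positivity, hc, ?_⟩
  intro ℓ U₀ D₀ Dⱼ U t β hU hint hD₀ hDⱼ ht hβ hβ'
  have hae := hU.fourier_ae_eq ht
  have hle : ∀ᵐ ξ : ℝ, ‖(𝓕 (U t) : L2State) ξ‖ ≤
      K * Real.exp (-(c * rate q (2 * Real.pi * ξ) * t)) * ‖(𝓕 U₀ : L2State) ξ‖ := by
    filter_upwards [hae] with ξ h
    rw [h]
    exact hexp _ t ht _
  -- For mere existence of the derivative the decay is discarded: the transform of the solution is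
  -- at most K times that of the datum.
  obtain ⟨D, hD⟩ := exists_hasL2Deriv_of_norm_fourier_le (h := U t) (K := K) hDⱼ (by
    filter_upwards [hle] with ξ h
    refine h.trans ?_
    gcongr
    refine mul_le_of_le_one_right hK0 (Real.exp_le_one_iff.2 ?_)
    have := rate_nonneg q (2 * Real.pi * ξ)
    exact neg_nonpos.2 (by positivity))
  refine ⟨D, hD, ?_⟩
  set M := ∫ x : ℝ, ‖U₀ x‖
  have hM : 0 ≤ M := integral_nonneg fun _ => norm_nonneg _
  obtain ⟨hgi, hg⟩ := hlow (1 + t) (by positivity)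
  set δ := (1 + t) ^ (-(1 / 8 : ℝ) - (j : ℝ) / 4)
  have hδ : 0 ≤ δ := by positivity
  have hsq : ‖D‖ ^ 2 ≤ (K * Real.exp c * M * (C * δ)) ^ 2 + (K * β * ‖D₀‖) ^ 2 := by
    rw [hD.norm_sq, mul_pow _ (C * δ), mul_pow _ ‖D₀‖, hD₀.norm_sq]
    refine (integral_mono_ae hD.integrable ((hgi.const_mul ((K * Real.exp c * M) ^ 2)).add
      (hD₀.integrable.const_mul ((K * β) ^ 2))) ?_).trans ?_
    · filter_upwards [hle, norm_fourier_lp_le U₀ hint] with ξ h1 h2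
      exact sq_norm_fourier_le hc hK0 (norm_nonneg _) (norm_nonneg _) h2 (hβ' _) h1
    · simp only [Pi.add_apply]
      rw [integral_add (hgi.const_mul _) (hD₀.integrable.const_mul _), integral_const_mul,
        integral_const_mul]
      gcongr
  have h1 : ‖D‖ ≤ K * Real.exp c * M * (C * δ) + K * β * ‖D₀‖ := by
    refine abs_le_of_sq_le_sq' ?_ (by positivity) |>.2
    have : 0 ≤ K * Real.exp c * M * (C * δ) * (K * β * ‖D₀‖) := by positivity
    nlinarith
  refine h1.trans ?_
  have h2 : 0 ≤ K * δ * M := by positivity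
  have h3 : 0 ≤ K * Real.exp c * C * β * ‖D₀‖ := by positivity
  linarith

end LaminatedBeam

end

theorem theorem3p5 (k₁ k₂ k₃ k₄ γ : ℝ) (hk₁ : 0 < k₁) (hk₂ : 0 < k₂) (hk₃ : 0 < k₃)
    (hk₄ : 0 < k₄) (hγ : 0 < γ) (N ℓ j : ℕ) (hℓ : 1 ≤ ℓ) (hℓN : ℓ ≤ N) (hj : j ≤ N - ℓ) :
    ∃ c₀ c₁ : ℝ, 0 < c₀ ∧ 0 < c₁ ∧
      ∀ (U₀ : LaminatedBeam.L2State) (U : ℝ → LaminatedBeam.L2State),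
        LaminatedBeam.MemH N U₀ →
        Integrable (fun x : ℝ => U₀ x) volume →
        LaminatedBeam.IsSolution k₁ k₂ k₃ k₄ γ 0 1 0 U₀ U →
        ∃ D₀ : LaminatedBeam.L2State, LaminatedBeam.HasL2Deriv (j + ℓ) U₀ D₀ ∧
          ∀ t : ℝ, 0 ≤ t →
            ∃ D : LaminatedBeam.L2State, LaminatedBeam.HasL2Deriv j (U t) D ∧
              ((k₁ = k₂ ∧ k₂ = k₃) →
                ‖D‖ ≤ c₀ * (1 + t) ^ (-(1 / 8 : ℝ) - (j : ℝ) / 4) * (∫ x : ℝ, ‖U₀ x‖)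
                  + c₀ * Real.exp (-c₁ * t) * ‖D₀‖) ∧
              (¬ (k₁ = k₂ ∧ k₂ = k₃) →
                ‖D‖ ≤ c₀ * (1 + t) ^ (-(1 / 8 : ℝ) - (j : ℝ) / 4) * (∫ x : ℝ, ‖U₀ x‖)
                  + c₀ * (1 + t) ^ (-(ℓ : ℝ) / 4) * ‖D₀‖) := by
  by_cases hk : k₁ = k₂ ∧ k₂ = k₃
  · obtain ⟨C, c, hC, hc, h⟩ := LaminatedBeam.exists_norm_deriv_le hk₁ hk₂ hk₃ hk₄ hγ
      (q := 0) (Or.inl ⟨rfl, hk⟩) j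
    refine ⟨C, c, hC, hc, fun U₀ U hN hint hU => ?_⟩
    obtain ⟨D₀, hD₀⟩ := hN.exists_hasL2Deriv (m := j + ℓ) (by omega)
    obtain ⟨Dⱼ, hDⱼ⟩ := hN.exists_hasL2Deriv (m := j) (by omega)
    refine ⟨D₀, hD₀, fun t ht => ?_⟩
    obtain ⟨D, hD, hle⟩ := h (β := Real.exp (-c * t)) hU hint hD₀ hDⱼ ht (Real.exp_pos _).le
      fun ω hω => by
        have hr : LaminatedBeam.rate 0 ω = 1 := by
          rw [LaminatedBeam.rate, if_neg hω.not_ge, pow_zero, inv_one]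
        rw [hr, mul_one, ← neg_mul]
        exact le_mul_of_one_le_right (Real.exp_pos _).le (one_le_pow₀ hω.le)
    exact ⟨D, hD, fun _ => hle, fun h' => absurd hk h'⟩
  · obtain ⟨C, c, hC, hc, h⟩ := LaminatedBeam.exists_norm_deriv_le hk₁ hk₂ hk₃ hk₄ hγ
      (q := 4) (Or.inr rfl) j
    -- The constant of the trade between derivatives and decay; it multiplies the second term only,
    -- and 1 + B lets one c₀ serve both.
    set B := Real.exp c * ((ℓ / 4 : ℝ) / c) ^ (ℓ / 4 : ℝ) with hB
    have hB0 : 0 < B := by positivity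
    refine ⟨C * (1 + B), c, by positivity, hc, fun U₀ U hN hint hU => ?_⟩
    obtain ⟨D₀, hD₀⟩ := hN.exists_hasL2Deriv (m := j + ℓ) (by omega)
    obtain ⟨Dⱼ, hDⱼ⟩ := hN.exists_hasL2Deriv (m := j) (by omega)
    refine ⟨D₀, hD₀, fun t ht => ?_⟩
    obtain ⟨D, hD, hle⟩ := h (β := B * (1 + t) ^ (-(ℓ : ℝ) / 4)) hU hint hD₀ hDⱼ ht
      (by positivity) fun ω hω => LaminatedBeam.exp_neg_rate_four_le hℓ hc ht hω
    refine ⟨D, hD, fun h' => absurd h' hk, fun _ => hle.trans ?_⟩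
    have hM : 0 ≤ ∫ x : ℝ, ‖U₀ x‖ := integral_nonneg fun _ => norm_nonneg _
    have h1 : C ≤ C * (1 + B) := le_mul_of_one_le_right hC.le (by linarith)
    have h2 : C * (B * (1 + t) ^ (-(ℓ : ℝ) / 4)) ≤ C * (1 + B) * (1 + t) ^ (-(ℓ : ℝ) / 4) := by
      rw [← mul_assoc]
      gcongr
      linarith
    gcongr
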